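/- Let $M_1,M_2$ be smooth manifolds, let $J_i$ be an almost complex structure on $M_i$ (a smooth field of endomorphisms of $TM_i$ with $J_i^2=-\mathrm{Id}$), and let $f:M_1\to M_2$ be a diffeomorphism. A differentiable map $h:(N,A)\to(N',A')$ between manifolds equipped with fields of endomorphisms of their tangent bundles is called $(A,A')$-holomorphic if $A'(h(x))\circ d_xh=d_xh\circ A(x)$ for every $x\in N$. The lift of $f$ to the cotangent bundles is $\widetilde f=(f,{}^t(df)^{-1}):T^*M_1\to T^*M_2$, which sends a covector $\xi$ at $x$ to the covector $\xi\circ(d_xf)^{-1}$ at $f(x)$. For a manifold $M$ with an almost complex structure $J$, let $\pi:T^*M\to M$ be the projection, $\theta_\xi(V)=\xi(d\pi V)$ the Liouville form and $\omega_{st}=d\theta$ the canonical symplectic form on $T^*M$. Let $\theta(J)$ be the one-form $\theta(J)_\xi(V)=\xi(J\,d\pi V)$, and let $J^c$ be the field of endomorphisms of $T(T^*M)$ defined by $d(\theta(J))=\omega_{st}(J^c\cdot,\cdot)$. For a tensor $R$ of type $(1,2)$ on $M$ let $\gamma(R)$ be the field of endomorphisms of $T(T^*M)$ defined by $\omega_{st}(\gamma(R)V,W)=\xi(R(d\pi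 V,d\pi W))$ for $V,W\in T_\xi T^*M$; in local coordinates $(x,p)$, $\gamma(R)=p_kR^k_{i,j}\,dx^i\otimes\partial_{p_j}$. The complete lift of $J$ is $$\widetilde J:=J^c-\tfrac12\gamma(JN_J),\qquad N_J(X,Y)=[JX,JY]-J[X,JY]-J[JX,Y]-[X,Y].$$ For a smooth connection $\nabla$ on $M$ with torsion $T$, let $\widetilde\nabla:=\nabla-\tfrac12T$, $(\widetilde\nabla J)(X,Y):=\widetilde\nabla_X(JY)-J\widetilde\nabla_XY$ and $[\widetilde\nabla J](X,Y):=-(\widetilde\nabla J)(X,Y)+(\widetilde\nabla J)(Y,X)$. The horizontal lift of $J$ is $$J^{H,\nabla}:=J^c+\gamma([\widetilde\nabla J]).$$ Then: (1) $\widetilde f$ is $(\widetilde{J_1},\widetilde{J_2})$-holomorphic if and only if $f$ is $(J_1,J_2)$-holomorphic. (2) For all smooth connections $\nabla_1$ on $M_1$ and $\nabla_2$ on $M_2$, $\widetilde f$ is $(J_1^{H,\nabla_1},J_2^{H,\nabla_2})$-holomorphic if and only if $f$ is $(J_1,J_2)$-holomorphic and $f_*[\widetilde{\nabla_1}J_1]=[\widetilde{\nabla_2}J_2]$,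 where $(f_*R)_y(u,v)=df\big(R(df^{-1}u,df^{-1}v)\big)$, $R$ being taken at $f^{-1}(y)$. -/

import Mathlib

open Bundle Set VectorField
open scoped Manifold ContDiff Topology

noncomputable section

namespace AlmostComplex

/-! ### Almost complex structures

Throughout, a smooth manifold is a manifold `M` without boundary modelled on a finite-dimensional
real vector space `E`, with model `𝓘(ℝ, E)` and of class `C^∞`. -/

/-- An almost complex structure on `M`: a smooth field `J` of endomorphisms of the tangent spaces
with `J² = -Id`. -/
structure AlmostComplexStructure (E : Type*) [NormedAddCommGroup E] [NormedSpace ℝ E]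
    (M : Type*) [TopologicalSpace M] [ChartedSpace E M] [IsManifold 𝓘(ℝ, E) ∞ M] where
  toFun : ∀ x : M, TangentSpace 𝓘(ℝ, E) x →L[ℝ] TangentSpace 𝓘(ℝ, E) x
  smooth : ContMDiff 𝓘(ℝ, E) (𝓘(ℝ, E).prod 𝓘(ℝ, E →L[ℝ] E)) ∞
    (fun x : M ↦ TotalSpace.mk' (E →L[ℝ] E)
      (E := fun x : M ↦ TangentSpace 𝓘(ℝ, E) x →L[ℝ] TangentSpace 𝓘(ℝ, E) x) x (toFun x))
  sq : ∀ (x : M) (v : TangentSpace 𝓘(ℝ, E) x), toFun x (toFun x v) = -v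

/-- A map `f` between manifolds carrying fields of tangent endomorphisms `J`, `J'` is
`(J, J')`-holomorphic if it is differentiable and `J' (f x) ∘ d_x f = d_x f ∘ J x` for all `x`. -/
def IsHolomorphic {E H E' H' : Type*}
    [NormedAddCommGroup E] [NormedSpace ℝ E] [TopologicalSpace H] (I : ModelWithCorners ℝ E H)
    [NormedAddCommGroup E'] [NormedSpace ℝ E'] [TopologicalSpace H'] (I' : ModelWithCorners ℝ E' H')
    {N N' : Type*} [TopologicalSpace N] [ChartedSpace H N] [TopologicalSpace N']
    [ChartedSpace H' N']
    (J : ∀ x : N, TangentSpace I x →L[ℝ] TangentSpace I x)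
    (J' : ∀ y : N', TangentSpace I' y →L[ℝ] TangentSpace I' y) (f : N → N') : Prop :=
  MDifferentiable I I' f ∧ ∀ x : N, (J' (f x)) ∘L (mfderiv I I' f x) = (mfderiv I I' f x) ∘L (J x)

section

variable {E H : Type*} [NormedAddCommGroup E] [NormedSpace ℝ E] [TopologicalSpace H]
  (I : ModelWithCorners ℝ E H) {N : Type*} [TopologicalSpace N] [ChartedSpace H N]

/-- The one-form `α` on `N` in the chart `φ` at `p`, that is, `(φ⁻¹)^* α`. -/
def chartForm (α : ∀ q : N, TangentSpace I q →L[ℝ] ℝ) (p : N) (y : E) : E →L[ℝ] ℝ :=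
  (α ((extChartAt I p).symm y)) ∘L (mfderiv 𝓘(ℝ, E) I (extChartAt I p).symm y)

/-- The differential at `p` of the chart `φ` at `p`. -/
def dChart (p : N) : TangentSpace I p →L[ℝ] E := mfderiv I 𝓘(ℝ, E) (extChartAt I p) p

/-- The exterior derivative of a one-form `α` on a manifold without boundary, computed in the
chart `φ` at `p`: if `β = (φ⁻¹)^* α` and `D β` is its derivative at `φ p`, then
`(dα)_p (u, v) = (D β (dφ u)) (dφ v) - (D β (dφ v)) (dφ u)`. -/
def extDerivOne [I.Boundaryless] (α : ∀ q : N, TangentSpace I q →L[ℝ] ℝ) (p : N) :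
    TangentSpace I p →L[ℝ] TangentSpace I p →L[ℝ] ℝ :=
  (ContinuousLinearMap.precomp ℝ (dChart I p)) ∘L
    (fderiv ℝ (chartForm I α p) (extChartAt I p p) -
      (fderiv ℝ (chartForm I α p) (extChartAt I p p)).flip) ∘L dChart I p

lemma extDerivOne_apply [I.Boundaryless] (α : ∀ q : N, TangentSpace I q →L[ℝ] ℝ) (p : N)
    (u v : TangentSpace I p) :
    extDerivOne I α p u v =
      fderiv ℝ (chartForm I α p) (extChartAt I p p) (dChart I p u) (dChart I p v) -
        fderiv ℝ (chartForm I α p) (extChartAt I p p) (dChart I p v) (dChart I p u) := rfl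

end

section

variable {E : Type*} [NormedAddCommGroup E] [NormedSpace ℝ E]
  {M : Type*} [TopologicalSpace M] [ChartedSpace E M] [IsManifold 𝓘(ℝ, E) ∞ M]

/-! ### The cotangent bundle and its canonical forms -/

/-- The cotangent space `T_x^* M`. -/
abbrev CotangentSpace (E : Type*) [NormedAddCommGroup E] [NormedSpace ℝ E]
    {M : Type*} [TopologicalSpace M] [ChartedSpace E M] (x : M) : Type _ :=
  TangentSpace 𝓘(ℝ, E) x →L[ℝ] Bundle.Trivial M ℝ x

/-- The cotangent bundle `T^* M`, with Mathlib's manifold structure on the total space of a smooth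
vector bundle. -/
abbrev CotangentBundle (E : Type*) [NormedAddCommGroup E] [NormedSpace ℝ E]
    (M : Type*) [TopologicalSpace M] [ChartedSpace E M] : Type _ :=
  TotalSpace (E →L[ℝ] ℝ) (fun x : M ↦ CotangentSpace E x)

/-- The model with corners of the manifold `T^* M`. -/
abbrev cotangentModel (E : Type*) [NormedAddCommGroup E] [NormedSpace ℝ E] :
    ModelWithCorners ℝ (E × (E →L[ℝ] ℝ)) (ModelProd E (E →L[ℝ] ℝ)) :=
  𝓘(ℝ, E).prod 𝓘(ℝ, E →L[ℝ] ℝ)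

/-- The differential `d_ξ π` of the projection `π : T^* M → M`. -/
def dProj (ξ : CotangentBundle E M) :
    TangentSpace (cotangentModel E) ξ →L[ℝ] TangentSpace 𝓘(ℝ, E) ξ.proj :=
  mfderiv (cotangentModel E) 𝓘(ℝ, E) (fun η : CotangentBundle E M ↦ η.proj) ξ

/-- The covector `ξ ∈ T_x^* M` as a linear form on `T_x M`. -/
def covector (ξ : CotangentBundle E M) : TangentSpace 𝓘(ℝ, E) ξ.proj →L[ℝ] ℝ := ξ.2

/-- The Liouville form `θ_ξ(V) = ξ (dπ V)`, locally `p_i dx^i`. -/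
def liouville (ξ : CotangentBundle E M) : TangentSpace (cotangentModel E) ξ →L[ℝ] ℝ :=
  covector ξ ∘L dProj ξ

/-- The canonical symplectic form `ω_st = dθ`, as the map `V ↦ ω_st(V, ·)`. -/
def omegaSt (ξ : CotangentBundle E M) :
    TangentSpace (cotangentModel E) ξ →L[ℝ] TangentSpace (cotangentModel E) ξ →L[ℝ] ℝ :=
  extDerivOne (cotangentModel E) liouville ξ

/-! The form `ω_st` is nondegenerate: in the canonical coordinates `(x, p)` it is
`(u, v) ↦ p(u) (x(v)) - p(v) (x(u))`. -/

lemma mdifferentiable_proj :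
    MDifferentiable (cotangentModel E) 𝓘(ℝ, E) (fun η : CotangentBundle E M ↦ η.proj) :=
  (Bundle.contMDiff_proj (n := ∞) (IB := 𝓘(ℝ, E)) (F := E →L[ℝ] ℝ)
    (fun x : M ↦ CotangentSpace E x)).mdifferentiable (by simp)

lemma extChartAt_cotangent_snd (ξ η : CotangentBundle E M)
    (h : η.proj ∈ (chartAt E ξ.proj).source) :
    (extChartAt (cotangentModel E) ξ η).2 =
      covector η ∘L (mfderiv 𝓘(ℝ, E) 𝓘(ℝ, E) (extChartAt 𝓘(ℝ, E) ξ.proj).symm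
        (extChartAt 𝓘(ℝ, E) ξ.proj η.proj)) := by
  rw [← mfderivWithin_univ, ← ModelWithCorners.range_eq_univ 𝓘(ℝ, E),
    ← TangentBundle.symmL_trivializationAt h, FiberBundle.extChartAt]
  simp [hom_trivializationAt, Trivialization.continuousLinearMap_apply]
  rfl

lemma extChartAt_cotangent_fst (ξ η : CotangentBundle E M) :
    (extChartAt (cotangentModel E) ξ η).1 = extChartAt 𝓘(ℝ, E) ξ.proj η.proj := by
  rw [FiberBundle.extChartAt]
  rfl

lemma chartForm_liouville (ξ : CotangentBundle E M) {y : E × (E →L[ℝ] ℝ)}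
    (hy : y ∈ (extChartAt (cotangentModel E) ξ).target) :
    chartForm (cotangentModel E) liouville ξ y =
      y.2 ∘L ContinuousLinearMap.fst ℝ E (E →L[ℝ] ℝ) := by
  rw [chartForm]
  set φ := extChartAt (cotangentModel E) ξ with hφ
  have hs : ∀ z ∈ φ.target, (φ.symm z).proj = (extChartAt 𝓘(ℝ, E) ξ.proj).symm z.1 ∧
      (φ.symm z).proj ∈ (chartAt E ξ.proj).source := by
    intro z hz
    have h1 := φ.map_target hz
    have h2 : (φ.symm z).proj ∈ (chartAt E ξ.proj).source := by
      rw [hφ, extChartAt_source, FiberBundle.chartedSpace_chartAt] at h1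
      simp only [mfld_simps] at h1
      exact h1.1.1
    refine ⟨?_, h2⟩
    have h3 := extChartAt_cotangent_fst ξ (φ.symm z)
    rw [← hφ, φ.right_inv hz] at h3
    rw [h3, (extChartAt 𝓘(ℝ, E) ξ.proj).left_inv (by simpa using h2)]
  have hto : IsOpen φ.target := isOpen_extChartAt_target ξ
  have hd : MDifferentiableAt 𝓘(ℝ, E × (E →L[ℝ] ℝ)) (cotangentModel E) φ.symm y := by
    have := mdifferentiableWithinAt_extChartAt_symm (I := cotangentModel E) (x := ξ) hy
    rwa [ModelWithCorners.range_eq_univ, mdifferentiableWithinAt_univ] at this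
  have hy1 : y.1 ∈ (extChartAt 𝓘(ℝ, E) ξ.proj).target := by
    have h3 := extChartAt_cotangent_fst ξ (φ.symm y)
    rw [← hφ, φ.right_inv hy] at h3
    rw [h3]
    exact (extChartAt 𝓘(ℝ, E) ξ.proj).map_source (by simpa using (hs y hy).2)
  have hd1 : MDifferentiableAt 𝓘(ℝ, E) 𝓘(ℝ, E) (extChartAt 𝓘(ℝ, E) ξ.proj).symm y.1 := by
    have := mdifferentiableWithinAt_extChartAt_symm (I := 𝓘(ℝ, E)) (x := ξ.proj) hy1
    rwa [ModelWithCorners.range_eq_univ, mdifferentiableWithinAt_univ] at this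
  have hfst : HasMFDerivAt 𝓘(ℝ, E × (E →L[ℝ] ℝ)) 𝓘(ℝ, E) (Prod.fst : E × (E →L[ℝ] ℝ) → E) y
      (ContinuousLinearMap.fst ℝ E (E →L[ℝ] ℝ)) := hasFDerivAt_fst.hasMFDerivAt
  have e1 : HasMFDerivAt 𝓘(ℝ, E × (E →L[ℝ] ℝ)) 𝓘(ℝ, E)
      ((fun η : CotangentBundle E M ↦ η.proj) ∘ φ.symm) y
      (dProj (φ.symm y) ∘L mfderiv 𝓘(ℝ, E × (E →L[ℝ] ℝ)) (cotangentModel E) φ.symm y) :=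
    (mdifferentiable_proj _).hasMFDerivAt.comp y hd.hasMFDerivAt
  have e2 : HasMFDerivAt 𝓘(ℝ, E × (E →L[ℝ] ℝ)) 𝓘(ℝ, E)
      ((extChartAt 𝓘(ℝ, E) ξ.proj).symm ∘ Prod.fst) y
      (mfderiv 𝓘(ℝ, E) 𝓘(ℝ, E) (extChartAt 𝓘(ℝ, E) ξ.proj).symm y.1 ∘L
        ContinuousLinearMap.fst ℝ E (E →L[ℝ] ℝ)) :=
    hd1.hasMFDerivAt.comp y hfst
  have e3 := hasMFDerivAt_unique e1 (e2.congr_of_eventuallyEq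
    (Filter.eventuallyEq_of_mem (hto.mem_nhds hy) fun z hz ↦ (hs z hz).1))
  have e4 := extChartAt_cotangent_snd ξ (φ.symm y) (hs y hy).2
  have e5 : extChartAt 𝓘(ℝ, E) ξ.proj (φ.symm y).proj = y.1 := by
    rw [← extChartAt_cotangent_fst, ← hφ, φ.right_inv hy]
  rw [e5, ← hφ, φ.right_inv hy] at e4
  ext v
  · exact (congr(covector (φ.symm y) ($e3 (v, 0)))).trans congr($e4.symm v)
  · exact (congr(covector (φ.symm y) ($e3 (0, v)))).trans congr($e4.symm 0)

lemma fderiv_comp_fst {F G : Type*} [NormedAddCommGroup F] [NormedSpace ℝ F]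
    [NormedAddCommGroup G] [NormedSpace ℝ G] (c : G →L[ℝ] F →L[ℝ] ℝ)
    (β : F × G → F × G →L[ℝ] ℝ) (p : F × G)
    (h : ∀ᶠ y in 𝓝 p, β y = c y.2 ∘L ContinuousLinearMap.fst ℝ F G) (u v : F × G) :
    fderiv ℝ β p u v = c u.2 v.1 := by
  let L : F × G →L[ℝ] F × G →L[ℝ] ℝ :=
    ((ContinuousLinearMap.compL ℝ (F × G) F ℝ).flip (ContinuousLinearMap.fst ℝ F G)) ∘L
      c ∘L ContinuousLinearMap.snd ℝ F G
  have hL : β =ᶠ[𝓝 p] L := h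
  rw [(L.hasFDerivAt.congr_of_eventuallyEq hL).fderiv]
  rfl

lemma fderiv_snd_comp_fst {F : Type*} [NormedAddCommGroup F] [NormedSpace ℝ F]
    (β : F × (F →L[ℝ] ℝ) → F × (F →L[ℝ] ℝ) →L[ℝ] ℝ) (p : F × (F →L[ℝ] ℝ))
    (h : ∀ᶠ y in 𝓝 p, β y = y.2 ∘L ContinuousLinearMap.fst ℝ F (F →L[ℝ] ℝ))
    (u v : F × (F →L[ℝ] ℝ)) : fderiv ℝ β p u v = u.2 v.1 :=
  fderiv_comp_fst (.id ℝ (F →L[ℝ] ℝ)) β p h u v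

lemma omegaSt_apply (ξ : CotangentBundle E M) (u v : TangentSpace (cotangentModel E) ξ) :
    omegaSt ξ u v =
      (dChart (cotangentModel E) ξ u).2 (dChart (cotangentModel E) ξ v).1 -
        (dChart (cotangentModel E) ξ v).2 (dChart (cotangentModel E) ξ u).1 := by
  have h := fderiv_snd_comp_fst (chartForm (cotangentModel E) liouville ξ)
    (extChartAt (cotangentModel E) ξ ξ) (Filter.eventually_of_mem (extChartAt_target_mem_nhds ξ)
      fun y hy ↦ chartForm_liouville ξ hy)
  rw [omegaSt, extDerivOne_apply, h, h]

lemma omegaSt_isInvertible [FiniteDimensional ℝ E] (ξ : CotangentBundle E M) :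
    (omegaSt ξ).IsInvertible := by
  have : FiniteDimensional ℝ (TangentSpace (cotangentModel E) ξ) :=
    inferInstanceAs (FiniteDimensional ℝ (E × (E →L[ℝ] ℝ)))
  have : T2Space (TangentSpace (cotangentModel E) ξ) :=
    inferInstanceAs (T2Space (E × (E →L[ℝ] ℝ)))
  obtain ⟨e, he⟩ : (dChart (cotangentModel E) ξ).IsInvertible :=
    isInvertible_mfderiv_extChartAt (mem_extChartAt_source (I := cotangentModel E) ξ)
  have hinj : Function.Injective (omegaSt ξ).toLinearMap := by
    rw [injective_iff_map_eq_zero]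
    intro u hu
    have h : ∀ w : E × (E →L[ℝ] ℝ),
        (e u : E × (E →L[ℝ] ℝ)).2 w.1 - w.2 (e u : E × (E →L[ℝ] ℝ)).1 = 0 := by
      intro w
      have h1 := omegaSt_apply ξ u (e.symm w)
      have h2 : omegaSt ξ u (e.symm w) = 0 := congr($hu (e.symm w))
      have h3 : e (e.symm w) = w := e.apply_symm_apply w
      rw [h2, ← he] at h1
      simp only [ContinuousLinearEquiv.coe_coe] at h1
      rw [h3] at h1
      exact h1.symm
    have h1 : (e u : E × (E →L[ℝ] ℝ)).2 = 0 := by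
      ext a
      simpa using h (a, 0)
    have h2 : (e u : E × (E →L[ℝ] ℝ)).1 = 0 := by
      refine SeparatingDual.eq_zero_of_forall_dual_eq_zero (R := ℝ) fun g ↦ ?_
      simpa using h (0, g)
    exact e.map_eq_zero_iff.1 (Prod.ext h2 h1)
  have hdim : Module.finrank ℝ (TangentSpace (cotangentModel E) ξ) =
      Module.finrank ℝ (TangentSpace (cotangentModel E) ξ →L[ℝ] ℝ) := by
    rw [← (LinearMap.toContinuousLinearMap (𝕜 := ℝ) (E := TangentSpace (cotangentModel E) ξ)
      (F' := ℝ)).finrank_eq]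
    exact Subspace.dual_finrank_eq.symm
  exact ⟨(LinearEquiv.ofInjectiveOfFinrankEq _ hinj hdim).toContinuousLinearEquiv, by ext; rfl⟩

/-! ### The tensors `θ(A)`, `θ(R)` and duality by `ω_st` -/

/-- The one-form `θ(A)` on `T^* M` of a field `A` of endomorphisms:
`θ(A)_ξ(V) = ξ (A (dπ V))`, locally `p_k A^k_l dx^l`. -/
def theta₁ (A : ∀ x : M, TangentSpace 𝓘(ℝ, E) x →L[ℝ] TangentSpace 𝓘(ℝ, E) x)
    (ξ : CotangentBundle E M) : TangentSpace (cotangentModel E) ξ →L[ℝ] ℝ :=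
  covector ξ ∘L A ξ.proj ∘L dProj ξ

/-- The covariant two-tensor `θ(R)` on `T^* M` of a tensor `R` of type `(1,2)`:
`θ(R)_ξ(V, W) = ξ (R (dπ V, dπ W))`, locally `p_k R^k_{ij} dx^i ⊗ dx^j`. -/
def theta₂ (R : ∀ x : M, TangentSpace 𝓘(ℝ, E) x →L[ℝ]
      TangentSpace 𝓘(ℝ, E) x →L[ℝ] TangentSpace 𝓘(ℝ, E) x)
    (ξ : CotangentBundle E M) :
    TangentSpace (cotangentModel E) ξ →L[ℝ] TangentSpace (cotangentModel E) ξ →L[ℝ] ℝ :=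
  (ContinuousLinearMap.precomp ℝ (dProj ξ)) ∘L
    (ContinuousLinearMap.postcomp (TangentSpace 𝓘(ℝ, E) ξ.proj) (covector ξ)) ∘L
      R ξ.proj ∘L dProj ξ

lemma theta₂_apply (R : ∀ x : M, TangentSpace 𝓘(ℝ, E) x →L[ℝ]
      TangentSpace 𝓘(ℝ, E) x →L[ℝ] TangentSpace 𝓘(ℝ, E) x)
    (ξ : CotangentBundle E M) (V W : TangentSpace (cotangentModel E) ξ) :
    theta₂ R ξ V W = covector ξ (R ξ.proj (dProj ξ V) (dProj ξ W)) := rfl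

/-- The endomorphism `A` of `T_ξ T^* M` with `ω_st(A V, W) = B(V, W)` for all `V`, `W`, which
exists and is unique since `ω_st` is nondegenerate. -/
def omegaSolve (ξ : CotangentBundle E M)
    (B : TangentSpace (cotangentModel E) ξ →L[ℝ] TangentSpace (cotangentModel E) ξ →L[ℝ] ℝ) :
    TangentSpace (cotangentModel E) ξ →L[ℝ] TangentSpace (cotangentModel E) ξ :=
  (omegaSt ξ).inverse ∘L B

lemma omegaSt_omegaSolve [FiniteDimensional ℝ E] (ξ : CotangentBundle E M)
    (B : TangentSpace (cotangentModel E) ξ →L[ℝ] TangentSpace (cotangentModel E) ξ →L[ℝ] ℝ)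
    (V W : TangentSpace (cotangentModel E) ξ) : omegaSt ξ (omegaSolve ξ B V) W = B V W := by
  obtain ⟨e, he⟩ := omegaSt_isInvertible ξ
  rw [omegaSolve, ← he, ContinuousLinearMap.inverse_equiv]
  exact congr($(e.apply_symm_apply (B V)) W)

/-! ### Tensors on an almost complex manifold -/

/-- The tensor `(X, Y) ↦ R(Y, X)`. -/
def flipTensor {x : M} (R : TangentSpace 𝓘(ℝ, E) x →L[ℝ]
      TangentSpace 𝓘(ℝ, E) x →L[ℝ] TangentSpace 𝓘(ℝ, E) x) :
    TangentSpace 𝓘(ℝ, E) x →L[ℝ] TangentSpace 𝓘(ℝ, E) x →L[ℝ] TangentSpace 𝓘(ℝ, E) x :=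
  ContinuousLinearMap.flip (E := E) (F := E) (G := E) R

@[simp]
lemma flipTensor_apply {x : M} (R : TangentSpace 𝓘(ℝ, E) x →L[ℝ]
      TangentSpace 𝓘(ℝ, E) x →L[ℝ] TangentSpace 𝓘(ℝ, E) x) (u v : TangentSpace 𝓘(ℝ, E) x) :
    flipTensor R u v = R v u := rfl

lemma AlmostComplexStructure.mdiffAt (J : AlmostComplexStructure E M)
    {X : ∀ x : M, TangentSpace 𝓘(ℝ, E) x} {x : M} (hX : MDiffAt (T% X) x) :
    MDiffAt (T% (fun y ↦ J.toFun y (X y))) x := by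
  have h := (J.smooth x).mdifferentiableAt (by simp)
  exact MDifferentiableAt.clm_bundle_apply h hX

/-- The expression `[JX, JY] - J[X, JY] - J[JX, Y] - [X, Y]` for two vector fields. -/
def nijenhuisAux (J : AlmostComplexStructure E M) (X Y : ∀ x : M, TangentSpace 𝓘(ℝ, E) x)
    (x : M) : TangentSpace 𝓘(ℝ, E) x :=
  mlieBracket 𝓘(ℝ, E) (fun y ↦ J.toFun y (X y)) (fun y ↦ J.toFun y (Y y)) x
    - J.toFun x (mlieBracket 𝓘(ℝ, E) X (fun y ↦ J.toFun y (Y y)) x)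
    - J.toFun x (mlieBracket 𝓘(ℝ, E) (fun y ↦ J.toFun y (X y)) Y x)
    - mlieBracket 𝓘(ℝ, E) X Y x

lemma nijenhuisAux_swap (J : AlmostComplexStructure E M) (X Y : ∀ x : M, TangentSpace 𝓘(ℝ, E) x)
    (x : M) : nijenhuisAux J X Y x = - nijenhuisAux J Y X x := by
  simp only [nijenhuisAux]
  rw [mlieBracket_swap_apply, mlieBracket_swap_apply (V := X), mlieBracket_swap_apply (V := X),
    mlieBracket_swap_apply (V := fun y ↦ J.toFun y (X y)) (W := Y)]
  simp
  module

variable [FiniteDimensional ℝ E]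

lemma nijenhuisAux_tensorial_left (J : AlmostComplexStructure E M) (x : M)
    (Y : ∀ x : M, TangentSpace 𝓘(ℝ, E) x) :
    TensorialAt 𝓘(ℝ, E) E (nijenhuisAux J · Y x) x where
  smul {f X} hf hX := by
    have e : (fun y ↦ J.toFun y ((f • X) y)) = f • (fun y ↦ J.toFun y (X y)) := by
      ext y; simp
    simp only [nijenhuisAux, e, mlieBracket_smul_left hf hX, mlieBracket_smul_left hf (J.mdiffAt hX)]
    simp [J.sq]
    module
  add {X X'} hX hX' := by
    have e : (fun y ↦ J.toFun y ((X + X') y))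
        = (fun y ↦ J.toFun y (X y)) + (fun y ↦ J.toFun y (X' y)) := by
      ext y; simp
    simp only [nijenhuisAux, e, mlieBracket_add_left hX hX',
      mlieBracket_add_left (J.mdiffAt hX) (J.mdiffAt hX')]
    simp
    module

lemma nijenhuisAux_tensorial_right (J : AlmostComplexStructure E M) (x : M)
    (X : ∀ x : M, TangentSpace 𝓘(ℝ, E) x) :
    TensorialAt 𝓘(ℝ, E) E (nijenhuisAux J X · x) x where
  smul {f Y} hf hY := by
    simp only [nijenhuisAux_swap J X]
    rw [(nijenhuisAux_tensorial_left J x X).smul hf hY]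
    simp
  add {Y Y'} hY hY' := by
    simp only [nijenhuisAux_swap J X]
    rw [(nijenhuisAux_tensorial_left J x X).add hY hY']
    module

/-- The Nijenhuis tensor `N_J(X, Y) = [JX, JY] - J[X, JY] - J[JX, Y] - [X, Y]`. -/
def nijenhuis (J : AlmostComplexStructure E M) (x : M) :
    TangentSpace 𝓘(ℝ, E) x →L[ℝ] TangentSpace 𝓘(ℝ, E) x →L[ℝ] TangentSpace 𝓘(ℝ, E) x :=
  TensorialAt.mkHom₂ (nijenhuisAux J · · x) x
    (fun Y _ ↦ nijenhuisAux_tensorial_left J x Y) (fun X _ ↦ nijenhuisAux_tensorial_right J x X)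

/-- The tensor `J N_J`. -/
def complexNijenhuis (J : AlmostComplexStructure E M) (x : M) :
    TangentSpace 𝓘(ℝ, E) x →L[ℝ] TangentSpace 𝓘(ℝ, E) x →L[ℝ] TangentSpace 𝓘(ℝ, E) x :=
  (ContinuousLinearMap.postcomp (TangentSpace 𝓘(ℝ, E) x) (J.toFun x)) ∘L nijenhuis J x

/-- A connection on `M`: a covariant derivative on `TM`, where `D Y x (X x)` is `(∇_X Y)(x)`. -/
abbrev Connection (E : Type*) [NormedAddCommGroup E] [NormedSpace ℝ E]
    (M : Type*) [TopologicalSpace M] [ChartedSpace E M] [IsManifold 𝓘(ℝ, E) ∞ M] : Type _ :=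
  CovariantDerivative 𝓘(ℝ, E) E (fun x : M ↦ TangentSpace 𝓘(ℝ, E) x)

/-- The symmetrized connection `∇ - T/2`, where `T` is the torsion of `∇`. -/
def symmetrized (D : Connection E M) : Connection E M :=
  D.addOneForm (fun x ↦ -(1 / 2 : ℝ) • flipTensor (D.torsion x))

/-- For a vector field `Y`, the endomorphism `X ↦ ∇_X (JY) - J ∇_X Y`. -/
def nablaAux (D : Connection E M) (J : AlmostComplexStructure E M)
    (Y : ∀ x : M, TangentSpace 𝓘(ℝ, E) x) (x : M) :
    TangentSpace 𝓘(ℝ, E) x →L[ℝ] TangentSpace 𝓘(ℝ, E) x :=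
  D (fun y ↦ J.toFun y (Y y)) x - J.toFun x ∘L D Y x

lemma nablaAux_tensorial (D : Connection E M) (J : AlmostComplexStructure E M) (x : M) :
    TensorialAt 𝓘(ℝ, E) E (nablaAux D J · x) x where
  smul {f Y} hf hY := by
    have e : (fun y ↦ J.toFun y ((f • Y) y)) = f • (fun y ↦ J.toFun y (Y y)) := by
      ext y; simp
    ext v
    simp only [nablaAux]
    rw [e, D.isCovariantDerivativeOnUniv.leibniz hY hf,
      D.isCovariantDerivativeOnUniv.leibniz (J.mdiffAt hY) hf]
    simp
    module
  add {Y Y'} hY hY' := by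
    have e : (fun y ↦ J.toFun y ((Y + Y') y))
        = (fun y ↦ J.toFun y (Y y)) + (fun y ↦ J.toFun y (Y' y)) := by
      ext y; simp
    ext v
    simp only [nablaAux]
    rw [e, D.isCovariantDerivativeOnUniv.add hY hY',
      D.isCovariantDerivativeOnUniv.add (J.mdiffAt hY) (J.mdiffAt hY')]
    simp
    module

/-- The tensor `(∇J)(X, Y) = ∇_X (JY) - J ∇_X Y`. -/
def nablaJ (D : Connection E M) (J : AlmostComplexStructure E M) (x : M) :
    TangentSpace 𝓘(ℝ, E) x →L[ℝ] TangentSpace 𝓘(ℝ, E) x →L[ℝ] TangentSpace 𝓘(ℝ, E) x :=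
  flipTensor (TensorialAt.mkHom (nablaAux D J · x) x (nablaAux_tensorial D J x))

/-- The tensor `(X, Y) ↦ -(∇J)(X, Y) + (∇J)(Y, X)`. -/
def bracketJ (D : Connection E M) (J : AlmostComplexStructure E M) (x : M) :
    TangentSpace 𝓘(ℝ, E) x →L[ℝ] TangentSpace 𝓘(ℝ, E) x →L[ℝ] TangentSpace 𝓘(ℝ, E) x :=
  -nablaJ D J x + flipTensor (nablaJ D J x)

/-! ### Lifts to the cotangent bundle -/

/-- The contraction `γ(R)` of a tensor of type `(1,2)`: the field of endomorphisms of `T T^* M` with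
`ω_st(γ(R) V, W) = θ(R)(V, W)`; in coordinates `γ(R) = p_k R^k_{ij} dx^i ⊗ ∂/∂p_j`. -/
def gamma (R : ∀ x : M, TangentSpace 𝓘(ℝ, E) x →L[ℝ]
      TangentSpace 𝓘(ℝ, E) x →L[ℝ] TangentSpace 𝓘(ℝ, E) x)
    (ξ : CotangentBundle E M) :
    TangentSpace (cotangentModel E) ξ →L[ℝ] TangentSpace (cotangentModel E) ξ :=
  omegaSolve ξ (theta₂ R ξ)

/-- The field `J^c` of endomorphisms of `T T^* M` with `d(θ(J)) = ω_st(J^c ·, ·)`. -/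
def basicLift (J : AlmostComplexStructure E M) (ξ : CotangentBundle E M) :
    TangentSpace (cotangentModel E) ξ →L[ℝ] TangentSpace (cotangentModel E) ξ :=
  omegaSolve ξ (extDerivOne (cotangentModel E) (theta₁ J.toFun) ξ)

/-- The complete lift `J^c - γ(J N_J) / 2` of `J`. -/
def completeLift (J : AlmostComplexStructure E M) (ξ : CotangentBundle E M) :
    TangentSpace (cotangentModel E) ξ →L[ℝ] TangentSpace (cotangentModel E) ξ :=
  basicLift J ξ - (1 / 2 : ℝ) • gamma (complexNijenhuis J) ξ

/-- The horizontal lift `J^{H,∇} = J^c + γ([∇'J])`, where `∇' = ∇ - T/2`. -/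
def horizontalLift (J : AlmostComplexStructure E M) (D : Connection E M)
    (ξ : CotangentBundle E M) :
    TangentSpace (cotangentModel E) ξ →L[ℝ] TangentSpace (cotangentModel E) ξ :=
  basicLift J ξ + gamma (bracketJ (symmetrized D) J) ξ

end

/-! ### Diffeomorphisms -/

section

variable {E₁ E₂ : Type*} [NormedAddCommGroup E₁] [NormedSpace ℝ E₁]
  [NormedAddCommGroup E₂] [NormedSpace ℝ E₂]
  {M₁ M₂ : Type*} [TopologicalSpace M₁] [ChartedSpace E₁ M₁]
  [TopologicalSpace M₂] [ChartedSpace E₂ M₂]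

/-- The lift `(f, ᵗ(df)⁻¹)` of a diffeomorphism `f` to the cotangent bundles:
a covector `ξ` at `x` is sent to the covector `ξ ∘ (d_x f)⁻¹` at `f x`. -/
def cotangentLift (f : M₁ ≃ₘ^∞⟮𝓘(ℝ, E₁), 𝓘(ℝ, E₂)⟯ M₂) (ξ : CotangentBundle E₁ M₁) :
    CotangentBundle E₂ M₂ :=
  ⟨f ξ.proj, covector ξ ∘L
    ((f.mfderivToContinuousLinearEquiv (by simp) ξ.proj).symm :
      TangentSpace 𝓘(ℝ, E₂) (f ξ.proj) →L[ℝ] TangentSpace 𝓘(ℝ, E₁) ξ.proj)⟩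

/-- The direct image of a tensor `R` of type `(1,2)` by a diffeomorphism `f`: with
`e = d_y (f⁻¹)`, `(f_* R)_y (u, v) = e⁻¹ (R (e u, e v))`, where `R` is taken at `f⁻¹ y`
and `e⁻¹ = df` at `f⁻¹ y`. -/
def pushTensor (f : M₁ ≃ₘ^∞⟮𝓘(ℝ, E₁), 𝓘(ℝ, E₂)⟯ M₂)
    (R : ∀ x : M₁, TangentSpace 𝓘(ℝ, E₁) x →L[ℝ]
      TangentSpace 𝓘(ℝ, E₁) x →L[ℝ] TangentSpace 𝓘(ℝ, E₁) x) (y : M₂) :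
    TangentSpace 𝓘(ℝ, E₂) y →L[ℝ] TangentSpace 𝓘(ℝ, E₂) y →L[ℝ] TangentSpace 𝓘(ℝ, E₂) y :=
  let e : TangentSpace 𝓘(ℝ, E₂) y ≃L[ℝ] TangentSpace 𝓘(ℝ, E₁) (f.symm y) :=
    f.symm.mfderivToContinuousLinearEquiv (by simp) y
  (ContinuousLinearMap.precomp (TangentSpace 𝓘(ℝ, E₂) y)
      (e : TangentSpace 𝓘(ℝ, E₂) y →L[ℝ] TangentSpace 𝓘(ℝ, E₁) (f.symm y))) ∘L
    (ContinuousLinearMap.postcomp (TangentSpace 𝓘(ℝ, E₁) (f.symm y))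
      (e.symm : TangentSpace 𝓘(ℝ, E₁) (f.symm y) →L[ℝ] TangentSpace 𝓘(ℝ, E₂) y)) ∘L
      R (f.symm y) ∘L (e : TangentSpace 𝓘(ℝ, E₂) y →L[ℝ] TangentSpace 𝓘(ℝ, E₁) (f.symm y))

end

end AlmostComplex

end

open AlmostComplex

/-!
Since `f̃` preserves the Liouville form, it is symplectic. Both `J̃` and `J^{H,∇}` are `ω_st`-duals
of two-forms `dθ(J) + θ(R)` on the cotangent bundle, with `θ(R)_ξ(V, W) = ξ(R(dπ V, dπ W))`, where
`R = -½ J N_J` for the complete lift and `R = [∇̃J]` for the horizontal one. So `f̃` intertwines two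
such lifts if and only if it pulls `dθ(J₂) + θ(R₂)` back to `dθ(J₁) + θ(R₁)`. Such a lift projects
to `J` on the base, whence `f` is holomorphic; then `f̃` pulls `θ(J₂)` back to `θ(J₁)`, and what
remains is `f_* R₁ = R₂`. For the complete lifts this last condition is automatic, because the
Nijenhuis tensor is natural.
-/

noncomputable section

namespace AlmostComplex

/-! ### Pullback of one-forms -/

section

variable {E H E' H' E'' H'' : Type*}
  [NormedAddCommGroup E] [NormedSpace ℝ E] [TopologicalSpace H] {I : ModelWithCorners ℝ E H}
  [NormedAddCommGroup E'] [NormedSpace ℝ E'] [TopologicalSpace H'] {I' : ModelWithCorners ℝ E' H'}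
  [NormedAddCommGroup E''] [NormedSpace ℝ E''] [TopologicalSpace H'']
  {I'' : ModelWithCorners ℝ E'' H''}
  {N N' N'' : Type*} [TopologicalSpace N] [ChartedSpace H N]
  [TopologicalSpace N'] [ChartedSpace H' N'] [TopologicalSpace N''] [ChartedSpace H'' N'']

variable (I I') in
/-- The pullback `F^* α` of a one-form `α` by a map `F`. -/
def pullbackForm (F : N → N') (α : ∀ q : N', TangentSpace I' q →L[ℝ] ℝ) (q : N) :
    TangentSpace I q →L[ℝ] ℝ :=
  α (F q) ∘L mfderiv I I' F q

lemma pullbackForm_congr_of_eventuallyEq {F G : N → N'} {q : N} (h : F =ᶠ[𝓝 q] G)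
    (α : ∀ q : N', TangentSpace I' q →L[ℝ] ℝ) :
    pullbackForm I I' F α q = pullbackForm I I' G α q := by
  have hα : (α (F q) : E' →L[ℝ] ℝ) = α (G q) := by rw [h.eq_of_nhds]
  exact ContinuousLinearMap.ext fun v ↦ congr($hα ($h.mfderiv_eq v))

lemma pullbackForm_comp {F : N → N'} {G : N' → N''} {q : N} (hG : MDifferentiableAt I' I'' G (F q))
    (hF : MDifferentiableAt I I' F q) (α : ∀ q : N'', TangentSpace I'' q →L[ℝ] ℝ) :
    pullbackForm I I'' (G ∘ F) α q = pullbackForm I I' F (pullbackForm I' I'' G α) q := by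
  rw [pullbackForm, mfderiv_comp q hG hF]
  rfl

lemma mdifferentiableAt_extChartAt_symm [I.Boundaryless] [IsManifold I 1 N] {p : N} {y : E}
    (hy : y ∈ (extChartAt I p).target) :
    MDifferentiableAt 𝓘(ℝ, E) I (extChartAt I p).symm y := by
  have h := mdifferentiableWithinAt_extChartAt_symm hy
  rwa [I.range_eq_univ, mdifferentiableWithinAt_univ] at h

lemma chartForm_pullbackForm_eventuallyEq [I.Boundaryless] [I'.Boundaryless] [IsManifold I 1 N]
    [IsManifold I' 1 N'] {F : N → N'} {p : N} (hF : ∀ᶠ q in 𝓝 p, MDifferentiableAt I I' F q)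
    (α : ∀ q : N', TangentSpace I' q →L[ℝ] ℝ) :
    chartForm I (pullbackForm I I' F α) p =ᶠ[𝓝 (extChartAt I p p)]
      pullbackForm 𝓘(ℝ, E) 𝓘(ℝ, E') (writtenInExtChartAt I I' p F) (chartForm I' α (F p)) := by
  have hsymm : Filter.Tendsto (extChartAt I p).symm (𝓝 (extChartAt I p p)) (𝓝 p) := by
    simpa only [ContinuousAt, extChartAt_to_inv] using continuousAt_extChartAt_symm (I := I) p
  have hsource : ∀ᶠ q in 𝓝 p, F q ∈ (extChartAt I' (F p)).source :=
    hF.self_of_nhds.continuousAt.eventually (extChartAt_source_mem_nhds (F p))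
  filter_upwards [hsymm.eventually hF, hsymm.eventually hsource, extChartAt_target_mem_nhds p]
    with y hFy hsy hy
  set φ := extChartAt I p
  set ψ := extChartAt I' (F p)
  set G := writtenInExtChartAt I I' p F
  have dφ : MDifferentiableAt 𝓘(ℝ, E) I φ.symm y := mdifferentiableAt_extChartAt_symm hy
  have dFφ : MDifferentiableAt 𝓘(ℝ, E) I' (F ∘ φ.symm) y := hFy.comp y dφ
  have dψ : MDifferentiableAt I' 𝓘(ℝ, E') ψ (F (φ.symm y)) :=
    mdifferentiableAt_extChartAt (by rwa [← extChartAt_source I'])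
  have hchart : F ∘ φ.symm =ᶠ[𝓝 y] ψ.symm ∘ G := by
    filter_upwards [dFφ.continuousAt.eventually ((isOpen_extChartAt_source (F p)).mem_nhds hsy)]
      with z hz using (ψ.left_inv hz).symm
  have dG : MDifferentiableAt 𝓘(ℝ, E) 𝓘(ℝ, E') G y := dψ.comp y dFφ
  have dψs : MDifferentiableAt 𝓘(ℝ, E') I' ψ.symm (G y) :=
    mdifferentiableAt_extChartAt_symm (ψ.map_source hsy)
  calc pullbackForm 𝓘(ℝ, E) I φ.symm (pullbackForm I I' F α) y
      = pullbackForm 𝓘(ℝ, E) I' (F ∘ φ.symm) α y := (pullbackForm_comp hFy dφ α).symm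
    _ = pullbackForm 𝓘(ℝ, E) I' (ψ.symm ∘ G) α y := pullbackForm_congr_of_eventuallyEq hchart α
    _ = pullbackForm 𝓘(ℝ, E) 𝓘(ℝ, E') G (chartForm I' α (F p)) y := pullbackForm_comp dψs dG α

lemma fderiv_clm_comp_fderiv_sub_swap {G : E → E'} {y : E} (hG : ContDiffAt ℝ 2 G y)
    {β : E' → E' →L[ℝ] ℝ} (hβ : DifferentiableAt ℝ β (G y)) (a b : E) :
    fderiv ℝ (fun z ↦ β (G z) ∘L fderiv ℝ G z) y a b -
        fderiv ℝ (fun z ↦ β (G z) ∘L fderiv ℝ G z) y b a =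
      fderiv ℝ β (G y) (fderiv ℝ G y a) (fderiv ℝ G y b) -
        fderiv ℝ β (G y) (fderiv ℝ G y b) (fderiv ℝ G y a) := by
  have hDG : DifferentiableAt ℝ (fderiv ℝ G) y :=
    (hG.fderiv_right (m := 1) (by norm_num)).differentiableAt (by norm_num)
  have h := (hβ.hasFDerivAt.comp y (hG.differentiableAt (by norm_num)).hasFDerivAt).clm_comp
    hDG.hasFDerivAt
  have happly (a b : E) : fderiv ℝ (fun z ↦ β (G z) ∘L fderiv ℝ G z) y a b =
      β (G y) (fderiv ℝ (fderiv ℝ G) y a b) +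
        fderiv ℝ β (G y) (fderiv ℝ G y a) (fderiv ℝ G y b) := congr($h.fderiv a b)
  rw [happly, happly, (hG.isSymmSndFDerivAt (by simp)).eq, add_sub_add_left_eq_sub]

lemma dChart_eq_id [IsManifold I 1 N] (p : N) : dChart I p = .id ℝ E :=
  mfderiv_extChartAt_self

lemma extDerivOne_eq_sub [I.Boundaryless] [IsManifold I 1 N]
    (α : ∀ q : N, TangentSpace I q →L[ℝ] ℝ) (p : N) (u v : TangentSpace I p) :
    extDerivOne I α p u v = fderiv ℝ (chartForm I α p) (extChartAt I p p) u v -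
      fderiv ℝ (chartForm I α p) (extChartAt I p p) v u := by
  rw [extDerivOne_apply, dChart_eq_id]
  rfl

lemma extDerivOne_pullbackForm [I.Boundaryless] [I'.Boundaryless] [IsManifold I 2 N]
    [IsManifold I' 2 N'] {F : N → N'} {p : N} (hF : ContMDiffAt I I' 2 F p)
    {α : ∀ q : N', TangentSpace I' q →L[ℝ] ℝ}
    (hα : DifferentiableAt ℝ (chartForm I' α (F p)) (extChartAt I' (F p) (F p)))
    (u v : TangentSpace I p) :
    extDerivOne I (pullbackForm I I' F α) p u v =
      extDerivOne I' α (F p) (mfderiv I I' F p u) (mfderiv I I' F p v) := by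
  have : IsManifold I 1 N := .of_le (n := 2) (by norm_num)
  have : IsManifold I' 1 N' := .of_le (n := 2) (by norm_num)
  set G := writtenInExtChartAt I I' p F
  set y := extChartAt I p p
  have hG : ContDiffAt ℝ 2 G y := by
    have h := (contMDiffAt_iff.1 hF).2
    rwa [I.range_eq_univ, contDiffWithinAt_univ] at h
  have hGy : G y = extChartAt I' (F p) (F p) :=
    congr(extChartAt I' (F p) (F $(extChartAt_to_inv p)))
  have hdG : mfderiv I I' F p = fderiv ℝ G y := by
    rw [(hF.mdifferentiableAt (by norm_num)).mfderiv, I.range_eq_univ, fderivWithin_univ]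
  have hF' : ∀ᶠ q in 𝓝 p, MDifferentiableAt I I' F q :=
    ((contMDiffAt_iff_contMDiffAt_nhds (by simp)).1 hF).mono
      fun q hq ↦ hq.mdifferentiableAt (by norm_num)
  have hchart : chartForm I (pullbackForm I I' F α) p =ᶠ[𝓝 y]
      fun z ↦ chartForm I' α (F p) (G z) ∘L fderiv ℝ G z :=
    (chartForm_pullbackForm_eventuallyEq hF' α).trans
      (.of_forall fun z ↦ congr(_ ∘L $(mfderiv_eq_fderiv)))
  rw [extDerivOne_eq_sub, extDerivOne_eq_sub, hchart.fderiv_eq, hdG, ← hGy]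
  exact fderiv_clm_comp_fderiv_sub_swap hG (hGy ▸ hα) u v

end

/-! ### Canonical coordinates of the cotangent bundle -/

section

variable {E : Type*} [NormedAddCommGroup E] [NormedSpace ℝ E]
  {M : Type*} [TopologicalSpace M] [ChartedSpace E M]

variable (E M) in
/-- A field of endomorphisms of the tangent spaces of `M`. -/
abbrev EndoField : Type _ := ∀ x : M, TangentSpace 𝓘(ℝ, E) x →L[ℝ] TangentSpace 𝓘(ℝ, E) x

variable (E M) in
/-- A field of tensors of type `(1,2)` on `M`. -/
abbrev TensorField₁₂ : Type _ :=
  ∀ x : M, TangentSpace 𝓘(ℝ, E) x →L[ℝ] TangentSpace 𝓘(ℝ, E) x →L[ℝ] TangentSpace 𝓘(ℝ, E) x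

variable [IsManifold 𝓘(ℝ, E) ∞ M]

/-- The field of endomorphisms `A` read in the chart at `x₀`: a matrix-valued function on `E`. -/
def chartField (A : EndoField E M) (x₀ : M) (z : E) : E →L[ℝ] E :=
  ContinuousLinearMap.inCoordinates E (TangentSpace 𝓘(ℝ, E)) E (TangentSpace 𝓘(ℝ, E))
    x₀ ((extChartAt 𝓘(ℝ, E) x₀).symm z) x₀ ((extChartAt 𝓘(ℝ, E) x₀).symm z)
    (A ((extChartAt 𝓘(ℝ, E) x₀).symm z))

/-- Differentiability of a field of endomorphisms, as a section of the bundle `Hom(TM, TM)`. -/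
def MDiffEndoFieldAt (A : EndoField E M) (x : M) : Prop :=
  MDifferentiableAt 𝓘(ℝ, E) (𝓘(ℝ, E).prod 𝓘(ℝ, E →L[ℝ] E))
    (fun x : M ↦ TotalSpace.mk' (E →L[ℝ] E)
      (E := fun x : M ↦ TangentSpace 𝓘(ℝ, E) x →L[ℝ] TangentSpace 𝓘(ℝ, E) x) x (A x)) x

lemma AlmostComplexStructure.mdiffEndoFieldAt (J : AlmostComplexStructure E M) (x : M) :
    MDiffEndoFieldAt J.toFun x :=
  (J.smooth x).mdifferentiableAt (by simp)

lemma MDiffEndoFieldAt.differentiableAt_chartField {A : EndoField E M} {x₀ : M}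
    (hA : MDiffEndoFieldAt A x₀) :
    DifferentiableAt ℝ (chartField A x₀) (extChartAt 𝓘(ℝ, E) x₀ x₀) := by
  have hA' : MDifferentiableAt 𝓘(ℝ, E) 𝓘(ℝ, E →L[ℝ] E) (fun x ↦
      ContinuousLinearMap.inCoordinates E (TangentSpace 𝓘(ℝ, E)) E (TangentSpace 𝓘(ℝ, E))
        x₀ x x₀ x (A x)) ((extChartAt 𝓘(ℝ, E) x₀).symm (extChartAt 𝓘(ℝ, E) x₀ x₀)) := by
    rw [extChartAt_to_inv]
    exact ((mdifferentiableAt_hom_bundle _).1 hA).2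
  exact (hA'.comp _ (mdifferentiableAt_extChartAt_symm
    (mem_extChartAt_target x₀))).differentiableAt

lemma chartField_extChartAt_self (A : EndoField E M) (x : M) :
    chartField A x (extChartAt 𝓘(ℝ, E) x x) = A x := by
  have htriv : Trivialization.continuousLinearMapAt ℝ
      (trivializationAt E (TangentSpace 𝓘(ℝ, E)) x) x = .id ℝ E :=
    (TangentBundle.continuousLinearMapAt_trivializationAt (mem_chart_source E x)).trans
      mfderiv_extChartAt_self
  have hsymm : Trivialization.symmL ℝ
      (trivializationAt E (TangentSpace 𝓘(ℝ, E)) x) x = .id ℝ E :=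
    (TangentBundle.symmL_trivializationAt (mem_chart_source E x)).trans
      mfderivWithin_range_extChartAt_symm
  rw [chartField, extChartAt_to_inv]
  exact congr($htriv ∘L A x ∘L $hsymm)

lemma proj_extChartAt_cotangent_symm_mem_source (ξ : CotangentBundle E M) {y : E × (E →L[ℝ] ℝ)}
    (hy : y ∈ (extChartAt (cotangentModel E) ξ).target) :
    ((extChartAt (cotangentModel E) ξ).symm y).proj ∈ (chartAt E ξ.proj).source := by
  have h := (extChartAt (cotangentModel E) ξ).map_target hy
  rw [extChartAt_source, FiberBundle.chartedSpace_chartAt] at h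
  simp only [mfld_simps] at h
  exact h.1.1

lemma extChartAt_proj_extChartAt_cotangent_symm (ξ : CotangentBundle E M) {y : E × (E →L[ℝ] ℝ)}
    (hy : y ∈ (extChartAt (cotangentModel E) ξ).target) :
    extChartAt 𝓘(ℝ, E) ξ.proj ((extChartAt (cotangentModel E) ξ).symm y).proj = y.1 := by
  rw [← extChartAt_cotangent_fst, (extChartAt (cotangentModel E) ξ).right_inv hy]

lemma proj_extChartAt_cotangent_symm (ξ : CotangentBundle E M) {y : E × (E →L[ℝ] ℝ)}
    (hy : y ∈ (extChartAt (cotangentModel E) ξ).target) :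
    ((extChartAt (cotangentModel E) ξ).symm y).proj = (extChartAt 𝓘(ℝ, E) ξ.proj).symm y.1 := by
  rw [← extChartAt_proj_extChartAt_cotangent_symm ξ hy, (extChartAt 𝓘(ℝ, E) ξ.proj).left_inv]
  rw [extChartAt_source]
  exact proj_extChartAt_cotangent_symm_mem_source ξ hy

lemma dProj_comp_mfderiv_extChartAt_symm (ξ : CotangentBundle E M) {y : E × (E →L[ℝ] ℝ)}
    (hy : y ∈ (extChartAt (cotangentModel E) ξ).target) :
    dProj ((extChartAt (cotangentModel E) ξ).symm y) ∘L
        mfderiv 𝓘(ℝ, E × (E →L[ℝ] ℝ)) (cotangentModel E) (extChartAt (cotangentModel E) ξ).symm y =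
      (Trivialization.symmL ℝ (trivializationAt E (TangentSpace 𝓘(ℝ, E)) ξ.proj)
        ((extChartAt (cotangentModel E) ξ).symm y).proj) ∘L
          ContinuousLinearMap.fst ℝ E (E →L[ℝ] ℝ) := by
  set φ := extChartAt (cotangentModel E) ξ
  set ψ := extChartAt 𝓘(ℝ, E) ξ.proj
  have hsource := proj_extChartAt_cotangent_symm_mem_source ξ hy
  have hy₁ : ψ (φ.symm y).proj = y.1 := extChartAt_proj_extChartAt_cotangent_symm ξ hy
  have hψ : MDifferentiableAt 𝓘(ℝ, E) 𝓘(ℝ, E) ψ.symm y.1 := by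
    rw [← hy₁]
    exact mdifferentiableAt_extChartAt_symm (ψ.map_source (by rwa [extChartAt_source]))
  have hπφ := (mdifferentiable_proj (φ.symm y)).hasMFDerivAt.comp y
    (mdifferentiableAt_extChartAt_symm (I := cotangentModel E) hy).hasMFDerivAt
  have hψfst := hψ.hasMFDerivAt.comp y
    (hasFDerivAt_fst (𝕜 := ℝ) (E := E) (F := E →L[ℝ] ℝ) (p := y)).hasMFDerivAt
  have hproj : (fun η : CotangentBundle E M ↦ η.proj) ∘ φ.symm =ᶠ[𝓝 y] ψ.symm ∘ Prod.fst :=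
    Filter.eventuallyEq_of_mem ((isOpen_extChartAt_target ξ).mem_nhds hy)
      fun z hz ↦ proj_extChartAt_cotangent_symm ξ hz
  rw [TangentBundle.symmL_trivializationAt hsource, ModelWithCorners.range_eq_univ,
    mfderivWithin_univ, hy₁]
  exact hasMFDerivAt_unique hπφ (hψfst.congr_of_eventuallyEq hproj)

lemma dProj_apply (ξ : CotangentBundle E M) (V : TangentSpace (cotangentModel E) ξ) :
    dProj ξ V = (V : E × (E →L[ℝ] ℝ)).1 := by
  have hψπ := (mdifferentiableAt_extChartAt (I := 𝓘(ℝ, E))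
    (mem_chart_source E ξ.proj)).hasMFDerivAt.comp ξ (mdifferentiable_proj ξ).hasMFDerivAt
  have hfstφ := (hasFDerivAt_fst (𝕜 := ℝ) (E := E) (F := E →L[ℝ] ℝ)
    (p := extChartAt (cotangentModel E) ξ ξ)).hasMFDerivAt.comp ξ
    (mdifferentiableAt_extChartAt (mem_chart_source _ ξ)).hasMFDerivAt
  rw [mfderiv_extChartAt_self] at hψπ hfstφ
  have hcomp : extChartAt 𝓘(ℝ, E) ξ.proj ∘ (fun η : CotangentBundle E M ↦ η.proj) =
      Prod.fst ∘ extChartAt (cotangentModel E) ξ :=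
    funext fun η ↦ (extChartAt_cotangent_fst ξ η).symm
  rw [hcomp] at hψπ
  exact congr($(hasMFDerivAt_unique hψπ hfstφ) V)

lemma dProj_surjective (ξ : CotangentBundle E M) : Function.Surjective (dProj ξ) :=
  fun v ↦ ⟨((v, 0) : E × (E →L[ℝ] ℝ)), dProj_apply ξ _⟩

/-- The vertical tangent vector `(0, g)` to `T^* M` at `ξ` given by a covector `g` at the base point
of `ξ`. -/
def verticalLift (ξ : CotangentBundle E M) (g : TangentSpace 𝓘(ℝ, E) ξ.proj →L[ℝ] ℝ) :
    TangentSpace (cotangentModel E) ξ :=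
  ((0, g) : E × (E →L[ℝ] ℝ))

lemma dProj_verticalLift (ξ : CotangentBundle E M) (g : TangentSpace 𝓘(ℝ, E) ξ.proj →L[ℝ] ℝ) :
    dProj ξ (verticalLift ξ g) = 0 :=
  dProj_apply ξ _

lemma omegaSt_verticalLift (ξ : CotangentBundle E M) (V : TangentSpace (cotangentModel E) ξ)
    (g : TangentSpace 𝓘(ℝ, E) ξ.proj →L[ℝ] ℝ) :
    omegaSt ξ V (verticalLift ξ g) = -g (dProj ξ V) := by
  rw [omegaSt_apply, dChart_eq_id, dProj_apply]
  exact (congr($(map_zero (V : E × (E →L[ℝ] ℝ)).2) - _)).trans (zero_sub _)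

lemma chartForm_theta₁ (A : EndoField E M) (ξ : CotangentBundle E M) {y : E × (E →L[ℝ] ℝ)}
    (hy : y ∈ (extChartAt (cotangentModel E) ξ).target) :
    chartForm (cotangentModel E) (theta₁ A) ξ y =
      y.2 ∘L chartField A ξ.proj y.1 ∘L ContinuousLinearMap.fst ℝ E (E →L[ℝ] ℝ) := by
  set η := (extChartAt (cotangentModel E) ξ).symm y
  set e := trivializationAt E (TangentSpace 𝓘(ℝ, E)) ξ.proj
  have hsource : η.proj ∈ (chartAt E ξ.proj).source :=
    proj_extChartAt_cotangent_symm_mem_source ξ hy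
  have hy₂ : y.2 = covector η ∘L Trivialization.symmL ℝ e η.proj := by
    rw [TangentBundle.symmL_trivializationAt hsource, ModelWithCorners.range_eq_univ,
      mfderivWithin_univ]
    refine Eq.trans ?_ (extChartAt_cotangent_snd ξ η hsource)
    rw [(extChartAt (cotangentModel E) ξ).right_inv hy]
  have he (w : TangentSpace 𝓘(ℝ, E) η.proj) :
      Trivialization.symmL ℝ e η.proj (Trivialization.continuousLinearMapAt ℝ e η.proj w) = w :=
    Trivialization.symmL_continuousLinearMapAt e
      (by rwa [TangentBundle.trivializationAt_baseSet]) w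
  rw [chartField, ← proj_extChartAt_cotangent_symm ξ hy, hy₂]
  refine ContinuousLinearMap.ext fun v ↦ ?_
  have hv := congr(covector η (A η.proj ($(dProj_comp_mfderiv_extChartAt_symm ξ hy) v)))
  exact hv.trans congr(covector η $((he _).symm))

lemma chartForm_theta₁_eventuallyEq (A : EndoField E M) (ξ : CotangentBundle E M) :
    chartForm (cotangentModel E) (theta₁ A) ξ =ᶠ[𝓝 (extChartAt (cotangentModel E) ξ ξ)]
      fun y ↦ y.2 ∘L chartField A ξ.proj y.1 ∘L ContinuousLinearMap.fst ℝ E (E →L[ℝ] ℝ) :=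
  Filter.eventuallyEq_of_mem (extChartAt_target_mem_nhds ξ) fun _ ↦ chartForm_theta₁ A ξ

lemma MDiffEndoFieldAt.differentiableAt_chartForm_theta₁ {A : EndoField E M}
    {ξ : CotangentBundle E M} (hA : MDiffEndoFieldAt A ξ.proj) :
    DifferentiableAt ℝ (chartForm (cotangentModel E) (theta₁ A) ξ)
      (extChartAt (cotangentModel E) ξ ξ) := by
  have hA' := hA.differentiableAt_chartField
  rw [← extChartAt_cotangent_fst] at hA'
  exact DifferentiableAt.congr_of_eventuallyEq (by fun_prop) (chartForm_theta₁_eventuallyEq A ξ)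

lemma fderiv_snd_comp_comp_fst_sub_swap_vertical {F : Type*} [NormedAddCommGroup F]
    [NormedSpace ℝ F] {B : F → F →L[ℝ] F} {p : F × (F →L[ℝ] ℝ)} (hB : DifferentiableAt ℝ B p.1)
    (u : F × (F →L[ℝ] ℝ)) (g : F →L[ℝ] ℝ) :
    let β : F × (F →L[ℝ] ℝ) → F × (F →L[ℝ] ℝ) →L[ℝ] ℝ :=
      fun y ↦ y.2 ∘L B y.1 ∘L ContinuousLinearMap.fst ℝ F (F →L[ℝ] ℝ)
    fderiv ℝ β p u (0, g) - fderiv ℝ β p (0, g) u = -g (B p.1 u.1) := by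
  intro β
  have hBfst := (hB.hasFDerivAt.comp p hasFDerivAt_fst).clm_comp
    (hasFDerivAt_const (ContinuousLinearMap.fst ℝ F (F →L[ℝ] ℝ)) p)
  have hβ (u v : F × (F →L[ℝ] ℝ)) :
      fderiv ℝ β p u v = u.2 (B p.1 v.1) + p.2 (fderiv ℝ B p.1 u.1 v.1) := by
    refine congr($((hasFDerivAt_snd.clm_comp hBfst).fderiv) u v).trans ?_
    simp [add_comm]
  simp [hβ]

lemma MDiffEndoFieldAt.extDerivOne_theta₁_verticalLift {A : EndoField E M}
    {ξ : CotangentBundle E M} (hA : MDiffEndoFieldAt A ξ.proj)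
    (V : TangentSpace (cotangentModel E) ξ) (g : TangentSpace 𝓘(ℝ, E) ξ.proj →L[ℝ] ℝ) :
    extDerivOne (cotangentModel E) (theta₁ A) ξ V (verticalLift ξ g) =
      -g (A ξ.proj (dProj ξ V)) := by
  have hA' := hA.differentiableAt_chartField
  rw [← extChartAt_cotangent_fst] at hA'
  have hAξ := chartField_extChartAt_self A ξ.proj
  rw [← extChartAt_cotangent_fst] at hAξ
  rw [extDerivOne_eq_sub, (chartForm_theta₁_eventuallyEq A ξ).fderiv_eq, dProj_apply, ← hAξ]
  exact fderiv_snd_comp_comp_fst_sub_swap_vertical hA' V g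

/-- The field of endomorphisms of `T T^* M` which is dual to `dθ(A) + θ(R)` with respect to `ω_st`.
Both the complete and the horizontal lifts are of this form. -/
def correctedLift (A : EndoField E M) (R : TensorField₁₂ E M) (ξ : CotangentBundle E M) :
    TangentSpace (cotangentModel E) ξ →L[ℝ] TangentSpace (cotangentModel E) ξ :=
  omegaSolve ξ (extDerivOne (cotangentModel E) (theta₁ A) ξ + theta₂ R ξ)

lemma dProj_correctedLift [FiniteDimensional ℝ E] {A : EndoField E M} {ξ : CotangentBundle E M}
    (hA : MDiffEndoFieldAt A ξ.proj) (R : TensorField₁₂ E M)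
    (V : TangentSpace (cotangentModel E) ξ) :
    dProj ξ (correctedLift A R ξ V) = A ξ.proj (dProj ξ V) := by
  suffices h : ∀ g : TangentSpace 𝓘(ℝ, E) ξ.proj →L[ℝ] ℝ,
      g (dProj ξ (correctedLift A R ξ V)) = g (A ξ.proj (dProj ξ V)) from
    (SeparatingDual.eq_iff_forall_dual_eq (R := ℝ) (V := E)).2 h
  intro g
  rw [← neg_inj, ← omegaSt_verticalLift, correctedLift, omegaSt_omegaSolve, add_apply, add_apply,
    hA.extDerivOne_theta₁_verticalLift, theta₂_apply, dProj_verticalLift, map_zero, map_zero,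
    add_zero]

end

/-! ### The lift of a diffeomorphism is symplectic -/

section

variable {E₁ E₂ : Type*} [NormedAddCommGroup E₁] [NormedSpace ℝ E₁]
  [NormedAddCommGroup E₂] [NormedSpace ℝ E₂]
  {M₁ M₂ : Type*} [TopologicalSpace M₁] [ChartedSpace E₁ M₁]
  [TopologicalSpace M₂] [ChartedSpace E₂ M₂]
  (f : M₁ ≃ₘ^∞⟮𝓘(ℝ, E₁), 𝓘(ℝ, E₂)⟯ M₂)

lemma mfderiv_symm_mfderiv (x : M₁) (u : TangentSpace 𝓘(ℝ, E₁) x) :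
    mfderiv 𝓘(ℝ, E₂) 𝓘(ℝ, E₁) f.symm (f x) (mfderiv 𝓘(ℝ, E₁) 𝓘(ℝ, E₂) f x u) = u := by
  have h := (f.symm.mdifferentiable (by simp) (f x)).hasMFDerivAt.comp x
    (f.mdifferentiable (by simp) x).hasMFDerivAt
  have hid : f.symm ∘ f = id := funext f.symm_apply_apply
  rw [hid] at h
  exact congr($(hasMFDerivAt_unique h (hasMFDerivAt_id x)) u)

lemma mfderiv_surjective (x : M₁) : Function.Surjective (mfderiv 𝓘(ℝ, E₁) 𝓘(ℝ, E₂) f x) :=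
  (f.mfderivToContinuousLinearEquiv (by simp) x).surjective

lemma covector_cotangentLift_mfderiv (ξ : CotangentBundle E₁ M₁)
    (u : TangentSpace 𝓘(ℝ, E₁) ξ.proj) :
    covector (cotangentLift f ξ) (mfderiv 𝓘(ℝ, E₁) 𝓘(ℝ, E₂) f ξ.proj u) = covector ξ u :=
  congr(covector ξ $((f.mfderivToContinuousLinearEquiv (by simp) ξ.proj).symm_apply_apply u))

lemma covector_cotangentLift (ξ : CotangentBundle E₁ M₁) (v : TangentSpace 𝓘(ℝ, E₂) (f ξ.proj)) :
    covector (cotangentLift f ξ) v =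
      (covector ξ : E₁ →L[ℝ] ℝ) (mfderiv 𝓘(ℝ, E₂) 𝓘(ℝ, E₁) f.symm (f ξ.proj) v) := by
  obtain ⟨u, rfl⟩ := mfderiv_surjective f ξ.proj v
  exact (covector_cotangentLift_mfderiv f ξ u).trans
    congr((covector ξ : E₁ →L[ℝ] ℝ) $((mfderiv_symm_mfderiv f ξ.proj u).symm))

lemma cotangentBundle_ext {ξ η : CotangentBundle E₁ M₁} (hproj : ξ.proj = η.proj)
    (hcovector : (covector ξ : E₁ →L[ℝ] ℝ) = covector η) : ξ = η := by
  obtain ⟨x, p⟩ := ξ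
  obtain ⟨y, q⟩ := η
  obtain rfl : x = y := hproj
  obtain rfl : p = q := hcovector
  rfl

lemma cotangentLift_symm_cotangentLift (ξ : CotangentBundle E₁ M₁) :
    cotangentLift f.symm (cotangentLift f ξ) = ξ := by
  refine cotangentBundle_ext (f.symm_apply_apply ξ.proj) (ContinuousLinearMap.ext fun v ↦ ?_)
  set p : E₁ →L[ℝ] ℝ := covector (cotangentLift f.symm (cotangentLift f ξ))
  calc p v
      = p (mfderiv 𝓘(ℝ, E₂) 𝓘(ℝ, E₁) f.symm (f ξ.proj) (mfderiv 𝓘(ℝ, E₁) 𝓘(ℝ, E₂) f ξ.proj v)) :=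
        congr(p $((mfderiv_symm_mfderiv f ξ.proj v).symm))
    _ = covector (cotangentLift f ξ) (mfderiv 𝓘(ℝ, E₁) 𝓘(ℝ, E₂) f ξ.proj v) :=
        covector_cotangentLift_mfderiv f.symm (cotangentLift f ξ) _
    _ = covector ξ v := covector_cotangentLift_mfderiv f ξ v

variable [IsManifold 𝓘(ℝ, E₁) ∞ M₁] [IsManifold 𝓘(ℝ, E₂) ∞ M₂]

lemma contMDiff_cotangentLift :
    ContMDiff (cotangentModel E₁) (cotangentModel E₂) ∞ (cotangentLift f) := by
  intro ξ₀
  set e := trivializationAt E₁ (TangentSpace 𝓘(ℝ, E₁)) ξ₀.proj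
  have hproj : ContMDiffAt (cotangentModel E₁) 𝓘(ℝ, E₁) ∞
      (fun η : CotangentBundle E₁ M₁ ↦ η.proj) ξ₀ := Bundle.contMDiffAt_proj _
  have hfproj : ContMDiffAt (cotangentModel E₁) 𝓘(ℝ, E₂) ∞
      (fun η : CotangentBundle E₁ M₁ ↦ f η.proj) ξ₀ := f.contMDiff.contMDiffAt.comp ξ₀ hproj
  have hcovector := ((contMDiffAt_hom_bundle (n := ∞) (IM := cotangentModel E₁) (IB := 𝓘(ℝ, E₁))
    (fun η : CotangentBundle E₁ M₁ ↦ η) (x₀ := ξ₀)).1 contMDiffAt_id).2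
  have hdf_symm := ((f.symm.contMDiff.contMDiffAt (x := f ξ₀.proj)).mfderiv_const (m := ∞)
    (by simp)).comp ξ₀ hfproj
  refine (contMDiffAt_hom_bundle _).2
    ⟨hfproj, (hcovector.clm_comp hdf_symm).congr_of_eventuallyEq ?_⟩
  filter_upwards [hproj.continuousAt.eventually
    (e.open_baseSet.mem_nhds (FiberBundle.mem_baseSet_trivializationAt' ξ₀.proj))] with η hη
  have he (x : M₁) (hx : η.proj = x) (w : TangentSpace 𝓘(ℝ, E₁) x) :
      Trivialization.symmL ℝ e η.proj (Trivialization.continuousLinearMapAt ℝ e x w) =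
        (w : E₁) := by
    subst hx
    exact Trivialization.symmL_continuousLinearMapAt e hη w
  ext v
  simp only [ContinuousLinearMap.inCoordinates, Trivial.fiberBundle_trivializationAt',
    Trivial.continuousLinearMapAt_trivialization, ContinuousLinearMap.id_comp,
    ContinuousLinearMap.comp_apply, Function.comp_apply, inTangentCoordinates,
    Diffeomorph.symm_apply_apply, id_eq, Trivialization.continuousLinearMapAt_apply]
  exact (covector_cotangentLift f η _).trans
    congr((covector η : E₁ →L[ℝ] ℝ) $((he _ (f.symm_apply_apply η.proj).symm _).symm))

/-- The lift of a diffeomorphism to the cotangent bundles, as a diffeomorphism. -/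
def cotangentDiffeomorph :
    CotangentBundle E₁ M₁ ≃ₘ^∞⟮cotangentModel E₁, cotangentModel E₂⟯ CotangentBundle E₂ M₂ where
  toFun := cotangentLift f
  invFun := cotangentLift f.symm
  left_inv := cotangentLift_symm_cotangentLift f
  right_inv := cotangentLift_symm_cotangentLift f.symm
  contMDiff_toFun := contMDiff_cotangentLift f
  contMDiff_invFun := contMDiff_cotangentLift f.symm

lemma mfderiv_cotangentLift_surjective (ξ : CotangentBundle E₁ M₁) : Function.Surjective
    (mfderiv (cotangentModel E₁) (cotangentModel E₂) (cotangentLift f) ξ) :=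
  ((cotangentDiffeomorph f).mfderivToContinuousLinearEquiv (by simp) ξ).surjective

lemma dProj_mfderiv_cotangentLift (ξ : CotangentBundle E₁ M₁)
    (V : TangentSpace (cotangentModel E₁) ξ) :
    dProj (cotangentLift f ξ)
        (mfderiv (cotangentModel E₁) (cotangentModel E₂) (cotangentLift f) ξ V) =
      mfderiv 𝓘(ℝ, E₁) 𝓘(ℝ, E₂) f ξ.proj (dProj ξ V) := by
  have hproj_lift := (mdifferentiable_proj (cotangentLift f ξ)).hasMFDerivAt.comp ξ
    ((contMDiff_cotangentLift f).mdifferentiable (by simp) ξ).hasMFDerivAt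
  have hf_proj := (f.mdifferentiable (by simp) ξ.proj).hasMFDerivAt.comp ξ
    (mdifferentiable_proj ξ).hasMFDerivAt
  exact congr($(hasMFDerivAt_unique hproj_lift hf_proj) V)

lemma pullbackForm_cotangentLift_theta₁ {A₁ : EndoField E₁ M₁} {A₂ : EndoField E₂ M₂}
    (hf : IsHolomorphic 𝓘(ℝ, E₁) 𝓘(ℝ, E₂) A₁ A₂ f) :
    pullbackForm (cotangentModel E₁) (cotangentModel E₂) (cotangentLift f) (theta₁ A₂) =
      theta₁ A₁ := by
  funext ξ
  refine ContinuousLinearMap.ext fun V ↦ ?_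
  have hA : A₂ (f ξ.proj) (dProj (cotangentLift f ξ)
      (mfderiv (cotangentModel E₁) (cotangentModel E₂) (cotangentLift f) ξ V)) =
      mfderiv 𝓘(ℝ, E₁) 𝓘(ℝ, E₂) f ξ.proj (A₁ ξ.proj (dProj ξ V)) :=
    congr(A₂ (f ξ.proj) $(dProj_mfderiv_cotangentLift f ξ V)).trans
      congr($(hf.2 ξ.proj) (dProj ξ V))
  exact congr(covector (cotangentLift f ξ) $hA).trans (covector_cotangentLift_mfderiv f ξ _)

lemma pullbackForm_cotangentLift_liouville :
    pullbackForm (cotangentModel E₁) (cotangentModel E₂) (cotangentLift f) liouville =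
      liouville :=
  pullbackForm_cotangentLift_theta₁ f (A₁ := fun _ ↦ .id ℝ _) (A₂ := fun _ ↦ .id ℝ _)
    ⟨f.mdifferentiable (by simp), fun _ ↦ rfl⟩

lemma extDerivOne_theta₁_mfderiv_cotangentLift {A₁ : EndoField E₁ M₁} {A₂ : EndoField E₂ M₂}
    {ξ : CotangentBundle E₁ M₁} (hA₂ : MDiffEndoFieldAt A₂ (f ξ.proj))
    (hf : IsHolomorphic 𝓘(ℝ, E₁) 𝓘(ℝ, E₂) A₁ A₂ f) (V W : TangentSpace (cotangentModel E₁) ξ) :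
    extDerivOne (cotangentModel E₂) (theta₁ A₂) (cotangentLift f ξ)
        (mfderiv (cotangentModel E₁) (cotangentModel E₂) (cotangentLift f) ξ V)
        (mfderiv (cotangentModel E₁) (cotangentModel E₂) (cotangentLift f) ξ W) =
      extDerivOne (cotangentModel E₁) (theta₁ A₁) ξ V W := by
  rw [← pullbackForm_cotangentLift_theta₁ f hf]
  exact (extDerivOne_pullbackForm ((contMDiff_cotangentLift f ξ).of_le ENat.LEInfty.out)
    (MDiffEndoFieldAt.differentiableAt_chartForm_theta₁ (ξ := cotangentLift f ξ) hA₂) V W).symm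

lemma omegaSt_mfderiv_cotangentLift (ξ : CotangentBundle E₁ M₁)
    (V W : TangentSpace (cotangentModel E₁) ξ) :
    omegaSt (cotangentLift f ξ)
        (mfderiv (cotangentModel E₁) (cotangentModel E₂) (cotangentLift f) ξ V)
        (mfderiv (cotangentModel E₁) (cotangentModel E₂) (cotangentLift f) ξ W) =
      omegaSt ξ V W := by
  have hdiff : DifferentiableAt ℝ (chartForm (cotangentModel E₂) liouville (cotangentLift f ξ))
      (extChartAt (cotangentModel E₂) (cotangentLift f ξ) (cotangentLift f ξ)) :=
    DifferentiableAt.congr_of_eventuallyEq (by fun_prop)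
      (Filter.eventuallyEq_of_mem (extChartAt_target_mem_nhds _) fun _ ↦ chartForm_liouville _)
  rw [omegaSt, omegaSt, ← pullbackForm_cotangentLift_liouville f]
  exact (extDerivOne_pullbackForm ((contMDiff_cotangentLift f ξ).of_le ENat.LEInfty.out)
    hdiff V W).symm

end

/-! ### Duality by the symplectic form and holomorphy of lifts -/

section

variable {E : Type*} [NormedAddCommGroup E] [NormedSpace ℝ E]
  {M : Type*} [TopologicalSpace M] [ChartedSpace E M] [IsManifold 𝓘(ℝ, E) ∞ M]

lemma omegaSt_injective [FiniteDimensional ℝ E] (ξ : CotangentBundle E M) :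
    Function.Injective (omegaSt ξ) := by
  obtain ⟨e, he⟩ := omegaSt_isInvertible ξ
  exact he ▸ e.injective

lemma theta₂_injective : Function.Injective (theta₂ (E := E) (M := M)) := by
  intro R S h
  funext x
  refine ContinuousLinearMap.ext fun u ↦ ContinuousLinearMap.ext fun v ↦
    (SeparatingDual.eq_iff_forall_dual_eq (R := ℝ) (V := E)).2 fun g ↦ ?_
  let ξ : CotangentBundle E M := ⟨x, g⟩
  obtain ⟨V, rfl⟩ := dProj_surjective ξ u
  obtain ⟨W, rfl⟩ := dProj_surjective ξ v
  exact congr($h ξ V W)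

end

section

variable {E₁ E₂ : Type*} [NormedAddCommGroup E₁] [NormedSpace ℝ E₁]
  [NormedAddCommGroup E₂] [NormedSpace ℝ E₂]
  {M₁ M₂ : Type*} [TopologicalSpace M₁] [ChartedSpace E₁ M₁]
  [TopologicalSpace M₂] [ChartedSpace E₂ M₂]
  (f : M₁ ≃ₘ^∞⟮𝓘(ℝ, E₁), 𝓘(ℝ, E₂)⟯ M₂)

lemma pushTensor_mfderiv (R : TensorField₁₂ E₁ M₁) (x : M₁) (u v : TangentSpace 𝓘(ℝ, E₁) x) :
    pushTensor f R (f x) (mfderiv 𝓘(ℝ, E₁) 𝓘(ℝ, E₂) f x u) (mfderiv 𝓘(ℝ, E₁) 𝓘(ℝ, E₂) f x v) =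
      mfderiv 𝓘(ℝ, E₁) 𝓘(ℝ, E₂) f x (R x u v) := by
  let e := f.symm.mfderivToContinuousLinearEquiv (by simp) (f x)
  have hR : (R (f.symm (f x)) : E₁ →L[ℝ] E₁ →L[ℝ] E₁) = R x := by rw [f.symm_apply_apply]
  exact e.symm_apply_eq.2 <|
    congr($hR $(mfderiv_symm_mfderiv f x u) $(mfderiv_symm_mfderiv f x v)).trans
      (mfderiv_symm_mfderiv f x (R x u v)).symm

lemma pushTensor_eq_of_mfderiv {R₁ : TensorField₁₂ E₁ M₁} {R₂ : TensorField₁₂ E₂ M₂}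
    (h : ∀ (x : M₁) (u v : TangentSpace 𝓘(ℝ, E₁) x), mfderiv 𝓘(ℝ, E₁) 𝓘(ℝ, E₂) f x (R₁ x u v) =
      R₂ (f x) (mfderiv 𝓘(ℝ, E₁) 𝓘(ℝ, E₂) f x u) (mfderiv 𝓘(ℝ, E₁) 𝓘(ℝ, E₂) f x v))
    (y : M₂) : pushTensor f R₁ y = R₂ y := by
  obtain ⟨x, rfl⟩ := f.surjective y
  refine ContinuousLinearMap.ext fun u' ↦ ContinuousLinearMap.ext fun v' ↦ ?_
  obtain ⟨u, rfl⟩ := mfderiv_surjective f x u'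
  obtain ⟨v, rfl⟩ := mfderiv_surjective f x v'
  exact (pushTensor_mfderiv f R₁ x u v).trans (h x u v)

variable [IsManifold 𝓘(ℝ, E₁) ∞ M₁] [IsManifold 𝓘(ℝ, E₂) ∞ M₂]

lemma theta₂_pushTensor_mfderiv_cotangentLift (R : TensorField₁₂ E₁ M₁)
    (ξ : CotangentBundle E₁ M₁) (V W : TangentSpace (cotangentModel E₁) ξ) :
    theta₂ (pushTensor f R) (cotangentLift f ξ)
        (mfderiv (cotangentModel E₁) (cotangentModel E₂) (cotangentLift f) ξ V)
        (mfderiv (cotangentModel E₁) (cotangentModel E₂) (cotangentLift f) ξ W) =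
      theta₂ R ξ V W := by
  rw [theta₂_apply, dProj_mfderiv_cotangentLift, dProj_mfderiv_cotangentLift]
  exact congr(covector (cotangentLift f ξ) $(pushTensor_mfderiv f R ξ.proj _ _)).trans
    (covector_cotangentLift_mfderiv f ξ _)

lemma theta₂_mfderiv_cotangentLift_iff (R₁ : TensorField₁₂ E₁ M₁) (R₂ : TensorField₁₂ E₂ M₂) :
    (∀ (ξ : CotangentBundle E₁ M₁) (V W : TangentSpace (cotangentModel E₁) ξ),
      theta₂ R₂ (cotangentLift f ξ)
          (mfderiv (cotangentModel E₁) (cotangentModel E₂) (cotangentLift f) ξ V)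
          (mfderiv (cotangentModel E₁) (cotangentModel E₂) (cotangentLift f) ξ W) =
        theta₂ R₁ ξ V W) ↔
      ∀ y, pushTensor f R₁ y = R₂ y := by
  rw [← funext_iff (f := pushTensor f R₁), ← theta₂_injective.eq_iff]
  refine ⟨fun h ↦ funext fun η ↦ ?_, fun h ξ V W ↦ ?_⟩
  · obtain ⟨ξ, rfl⟩ := (cotangentDiffeomorph f).surjective η
    refine ContinuousLinearMap.ext fun V' ↦ ContinuousLinearMap.ext fun W' ↦ ?_
    obtain ⟨V, rfl⟩ := mfderiv_cotangentLift_surjective f ξ V'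
    obtain ⟨W, rfl⟩ := mfderiv_cotangentLift_surjective f ξ W'
    exact (theta₂_pushTensor_mfderiv_cotangentLift f R₁ ξ V W).trans (h ξ V W).symm
  · rw [← h, theta₂_pushTensor_mfderiv_cotangentLift]

variable [FiniteDimensional ℝ E₁] [FiniteDimensional ℝ E₂]

lemma omegaSolve_comp_mfderiv_cotangentLift_iff {ξ : CotangentBundle E₁ M₁}
    (B₁ : TangentSpace (cotangentModel E₁) ξ →L[ℝ] TangentSpace (cotangentModel E₁) ξ →L[ℝ] ℝ)
    (B₂ : TangentSpace (cotangentModel E₂) (cotangentLift f ξ) →L[ℝ]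
      TangentSpace (cotangentModel E₂) (cotangentLift f ξ) →L[ℝ] ℝ) :
    omegaSolve (cotangentLift f ξ) B₂ ∘L
          mfderiv (cotangentModel E₁) (cotangentModel E₂) (cotangentLift f) ξ =
        mfderiv (cotangentModel E₁) (cotangentModel E₂) (cotangentLift f) ξ ∘L omegaSolve ξ B₁ ↔
      ∀ V W, B₂ (mfderiv (cotangentModel E₁) (cotangentModel E₂) (cotangentLift f) ξ V)
        (mfderiv (cotangentModel E₁) (cotangentModel E₂) (cotangentLift f) ξ W) = B₁ V W := by
  have hdual (V W : TangentSpace (cotangentModel E₁) ξ) :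
      omegaSt (cotangentLift f ξ)
        (mfderiv (cotangentModel E₁) (cotangentModel E₂) (cotangentLift f) ξ (omegaSolve ξ B₁ V))
        (mfderiv (cotangentModel E₁) (cotangentModel E₂) (cotangentLift f) ξ W) = B₁ V W := by
    rw [omegaSt_mfderiv_cotangentLift, omegaSt_omegaSolve]
  rw [ContinuousLinearMap.ext_iff]
  refine forall_congr' fun V ↦ ?_
  rw [← (omegaSt_injective (cotangentLift f ξ)).eq_iff, ContinuousLinearMap.ext_iff,
    (mfderiv_cotangentLift_surjective f ξ).forall]
  refine forall_congr' fun W ↦ ?_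
  rw [ContinuousLinearMap.comp_apply, ContinuousLinearMap.comp_apply, omegaSt_omegaSolve, hdual]

variable {f}

lemma IsHolomorphic.of_cotangentLift {A₁ : EndoField E₁ M₁} {A₂ : EndoField E₂ M₂}
    (hA₁ : ∀ x, MDiffEndoFieldAt A₁ x) (hA₂ : ∀ y, MDiffEndoFieldAt A₂ y)
    {R₁ : TensorField₁₂ E₁ M₁} {R₂ : TensorField₁₂ E₂ M₂}
    (h : IsHolomorphic (cotangentModel E₁) (cotangentModel E₂)
      (correctedLift A₁ R₁) (correctedLift A₂ R₂) (cotangentLift f)) :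
    IsHolomorphic 𝓘(ℝ, E₁) 𝓘(ℝ, E₂) A₁ A₂ f := by
  refine ⟨f.mdifferentiable (by simp), fun x ↦ ContinuousLinearMap.ext fun u ↦ ?_⟩
  let ξ : CotangentBundle E₁ M₁ := ⟨x, 0⟩
  obtain ⟨V, hV⟩ := dProj_surjective ξ u
  have hproj := congr(dProj (cotangentLift f ξ) ($(h.2 ξ) V))
  rw [ContinuousLinearMap.comp_apply, ContinuousLinearMap.comp_apply,
    dProj_correctedLift (hA₂ _), dProj_mfderiv_cotangentLift, dProj_mfderiv_cotangentLift,
    dProj_correctedLift (hA₁ _), hV] at hproj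
  exact hproj

lemma isHolomorphic_cotangentLift_correctedLift_iff {A₁ : EndoField E₁ M₁}
    {A₂ : EndoField E₂ M₂} (hA₁ : ∀ x, MDiffEndoFieldAt A₁ x)
    (hA₂ : ∀ y, MDiffEndoFieldAt A₂ y) (R₁ : TensorField₁₂ E₁ M₁) (R₂ : TensorField₁₂ E₂ M₂) :
    IsHolomorphic (cotangentModel E₁) (cotangentModel E₂)
        (correctedLift A₁ R₁) (correctedLift A₂ R₂) (cotangentLift f) ↔
      IsHolomorphic 𝓘(ℝ, E₁) 𝓘(ℝ, E₂) A₁ A₂ f ∧ ∀ y, pushTensor f R₁ y = R₂ y := by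
  rw [← and_iff_right_of_imp (IsHolomorphic.of_cotangentLift hA₁ hA₂ (f := f))]
  refine and_congr_right fun hf ↦ ?_
  rw [IsHolomorphic, and_iff_right ((contMDiff_cotangentLift f).mdifferentiable (by simp)),
    ← theta₂_mfderiv_cotangentLift_iff]
  refine forall_congr' fun ξ ↦ (omegaSolve_comp_mfderiv_cotangentLift_iff f _ _).trans ?_
  refine forall₂_congr fun V W ↦ ?_
  rw [add_apply, add_apply, add_apply, add_apply,
    extDerivOne_theta₁_mfderiv_cotangentLift f (hA₂ _) hf, add_right_inj]

end

/-! ### Naturality of the Nijenhuis tensor -/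

section

variable {E₁ E₂ : Type*} [NormedAddCommGroup E₁] [NormedSpace ℝ E₁]
  [NormedAddCommGroup E₂] [NormedSpace ℝ E₂]
  {M₁ M₂ : Type*} [TopologicalSpace M₁] [ChartedSpace E₁ M₁]
  [TopologicalSpace M₂] [ChartedSpace E₂ M₂]

lemma isInvertible_mfderiv (f : M₁ ≃ₘ^∞⟮𝓘(ℝ, E₁), 𝓘(ℝ, E₂)⟯ M₂) (x : M₁) :
    (mfderiv 𝓘(ℝ, E₁) 𝓘(ℝ, E₂) f x).IsInvertible :=
  ⟨f.mfderivToContinuousLinearEquiv (by simp) x, rfl⟩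

lemma mfderiv_mpullback (f : M₁ ≃ₘ^∞⟮𝓘(ℝ, E₁), 𝓘(ℝ, E₂)⟯ M₂)
    (X : ∀ y : M₂, TangentSpace 𝓘(ℝ, E₂) y) (x : M₁) :
    mfderiv 𝓘(ℝ, E₁) 𝓘(ℝ, E₂) f x (mpullback 𝓘(ℝ, E₁) 𝓘(ℝ, E₂) f X x) = X (f x) := by
  rw [mpullback_apply, ← ContinuousLinearMap.comp_apply,
    (isInvertible_mfderiv f x).self_comp_inverse]
  rfl

variable {f : M₁ ≃ₘ^∞⟮𝓘(ℝ, E₁), 𝓘(ℝ, E₂)⟯ M₂}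

lemma IsHolomorphic.mpullback_apply {A₁ : EndoField E₁ M₁} {A₂ : EndoField E₂ M₂}
    (hf : IsHolomorphic 𝓘(ℝ, E₁) 𝓘(ℝ, E₂) A₁ A₂ f) (X : ∀ y : M₂, TangentSpace 𝓘(ℝ, E₂) y) :
    mpullback 𝓘(ℝ, E₁) 𝓘(ℝ, E₂) f (fun y ↦ A₂ y (X y)) =
      fun x ↦ A₁ x (mpullback 𝓘(ℝ, E₁) 𝓘(ℝ, E₂) f X x) := by
  funext x
  apply (isInvertible_mfderiv f x).injective
  have hA := congr($(hf.2 x) (mpullback 𝓘(ℝ, E₁) 𝓘(ℝ, E₂) f X x))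
  rw [ContinuousLinearMap.comp_apply, mfderiv_mpullback] at hA
  rw [mfderiv_mpullback, hA, ContinuousLinearMap.comp_apply]

variable [IsManifold 𝓘(ℝ, E₁) ∞ M₁] [IsManifold 𝓘(ℝ, E₂) ∞ M₂]
  [FiniteDimensional ℝ E₁]
  {J₁ : AlmostComplexStructure E₁ M₁} {J₂ : AlmostComplexStructure E₂ M₂}

lemma nijenhuis_apply {X Y : ∀ x : M₁, TangentSpace 𝓘(ℝ, E₁) x} {x : M₁}
    (hX : MDiffAt (T% X) x) (hY : MDiffAt (T% Y) x) :
    nijenhuis J₁ x (X x) (Y x) = nijenhuisAux J₁ X Y x :=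
  TensorialAt.mkHom₂_apply (Φ := (nijenhuisAux J₁ · · x))
    (fun Y _ ↦ nijenhuisAux_tensorial_left J₁ x Y)
    (fun X _ ↦ nijenhuisAux_tensorial_right J₁ x X) hX hY

lemma IsHolomorphic.mfderiv_nijenhuisAux_mpullback
    (hf : IsHolomorphic 𝓘(ℝ, E₁) 𝓘(ℝ, E₂) J₁.toFun J₂.toFun f)
    {X Y : ∀ y : M₂, TangentSpace 𝓘(ℝ, E₂) y} {x : M₁}
    (hX : MDiffAt (T% X) (f x)) (hY : MDiffAt (T% Y) (f x)) :
    mfderiv 𝓘(ℝ, E₁) 𝓘(ℝ, E₂) f x (nijenhuisAux J₁ (mpullback 𝓘(ℝ, E₁) 𝓘(ℝ, E₂) f X)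
      (mpullback 𝓘(ℝ, E₁) 𝓘(ℝ, E₂) f Y) x) = nijenhuisAux J₂ X Y (f x) := by
  have : IsManifold 𝓘(ℝ, E₁) (minSmoothness ℝ 2) M₁ := by
    rw [minSmoothness_of_isRCLikeNormedField]
    infer_instance
  have : IsManifold 𝓘(ℝ, E₂) (minSmoothness ℝ 2) M₂ := by
    rw [minSmoothness_of_isRCLikeNormedField]
    infer_instance
  have hbracket {Z W : ∀ y : M₂, TangentSpace 𝓘(ℝ, E₂) y} (hZ : MDiffAt (T% Z) (f x))
      (hW : MDiffAt (T% W) (f x)) :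
      mfderiv 𝓘(ℝ, E₁) 𝓘(ℝ, E₂) f x (mlieBracket 𝓘(ℝ, E₁) (mpullback 𝓘(ℝ, E₁) 𝓘(ℝ, E₂) f Z)
        (mpullback 𝓘(ℝ, E₁) 𝓘(ℝ, E₂) f W) x) = mlieBracket 𝓘(ℝ, E₂) Z W (f x) := by
    rw [← mpullback_mlieBracket hZ hW (f.contMDiff x) (by simpa using ENat.LEInfty.out),
      mfderiv_mpullback]
  have hJ (w : TangentSpace 𝓘(ℝ, E₁) x) : mfderiv 𝓘(ℝ, E₁) 𝓘(ℝ, E₂) f x (J₁.toFun x w) =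
      J₂.toFun (f x) (mfderiv 𝓘(ℝ, E₁) 𝓘(ℝ, E₂) f x w) := congr($(hf.2 x) w).symm
  rw [nijenhuisAux, nijenhuisAux, ← hf.mpullback_apply, ← hf.mpullback_apply, map_sub, map_sub,
    map_sub, hJ, hJ, hbracket hX hY, hbracket (J₂.mdiffAt hX) hY, hbracket hX (J₂.mdiffAt hY),
    hbracket (J₂.mdiffAt hX) (J₂.mdiffAt hY)]

variable [FiniteDimensional ℝ E₂]

lemma IsHolomorphic.mfderiv_nijenhuis
    (hf : IsHolomorphic 𝓘(ℝ, E₁) 𝓘(ℝ, E₂) J₁.toFun J₂.toFun f) (x : M₁)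
    (u v : TangentSpace 𝓘(ℝ, E₁) x) :
    mfderiv 𝓘(ℝ, E₁) 𝓘(ℝ, E₂) f x (nijenhuis J₁ x u v) =
      nijenhuis J₂ (f x) (mfderiv 𝓘(ℝ, E₁) 𝓘(ℝ, E₂) f x u)
        (mfderiv 𝓘(ℝ, E₁) 𝓘(ℝ, E₂) f x v) := by
  set df := mfderiv 𝓘(ℝ, E₁) 𝓘(ℝ, E₂) f x
  have hextend (w : TangentSpace 𝓘(ℝ, E₁) x) :
      mpullback 𝓘(ℝ, E₁) 𝓘(ℝ, E₂) f (FiberBundle.extend E₂ (df w)) x = w := by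
    apply (isInvertible_mfderiv f x).injective
    rw [mfderiv_mpullback, FiberBundle.extend_apply_self]
  have hdiff (w : TangentSpace 𝓘(ℝ, E₂) (f x)) : MDiffAt (T% (FiberBundle.extend E₂ w)) (f x) :=
    FiberBundle.mdifferentiableAt_extend ..
  have hdiff' (w : TangentSpace 𝓘(ℝ, E₂) (f x)) :
      MDiffAt (T% (mpullback 𝓘(ℝ, E₁) 𝓘(ℝ, E₂) f (FiberBundle.extend E₂ w))) x :=
    (hdiff w).mpullback_vectorField (f.contMDiff x) (isInvertible_mfderiv f x) ENat.LEInfty.out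
  have h := hf.mfderiv_nijenhuisAux_mpullback (hdiff (df u)) (hdiff (df v))
  rw [← nijenhuis_apply (hdiff' _) (hdiff' _), hextend, hextend,
    ← nijenhuis_apply (hdiff _) (hdiff _), FiberBundle.extend_apply_self,
    FiberBundle.extend_apply_self] at h
  exact h

lemma IsHolomorphic.mfderiv_complexNijenhuis
    (hf : IsHolomorphic 𝓘(ℝ, E₁) 𝓘(ℝ, E₂) J₁.toFun J₂.toFun f) (x : M₁)
    (u v : TangentSpace 𝓘(ℝ, E₁) x) :
    mfderiv 𝓘(ℝ, E₁) 𝓘(ℝ, E₂) f x (complexNijenhuis J₁ x u v) =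
      complexNijenhuis J₂ (f x) (mfderiv 𝓘(ℝ, E₁) 𝓘(ℝ, E₂) f x u)
        (mfderiv 𝓘(ℝ, E₁) 𝓘(ℝ, E₂) f x v) :=
  congr($(hf.2 x) (nijenhuis J₁ x u v)).symm.trans
    congr(J₂.toFun (f x) $(hf.mfderiv_nijenhuis x u v))

end

/-! ### The complete and horizontal lifts -/

section

variable {E : Type*} [NormedAddCommGroup E] [NormedSpace ℝ E] [FiniteDimensional ℝ E]
  {M : Type*} [TopologicalSpace M] [ChartedSpace E M] [IsManifold 𝓘(ℝ, E) ∞ M]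

lemma completeLift_eq_correctedLift (J : AlmostComplexStructure E M) :
    completeLift J =
      correctedLift J.toFun (fun x ↦ (-(1 / 2) : ℝ) • complexNijenhuis J x) := by
  funext ξ
  have hθ : theta₂ (fun x ↦ (-(1 / 2) : ℝ) • complexNijenhuis J x) ξ =
      (-(1 / 2) : ℝ) • theta₂ (complexNijenhuis J) ξ :=
    ContinuousLinearMap.ext fun _ ↦ ContinuousLinearMap.ext fun _ ↦ map_smul (covector ξ) _ _
  rw [correctedLift, hθ, omegaSolve, ContinuousLinearMap.comp_add, ContinuousLinearMap.comp_smul,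
    neg_smul, ← sub_eq_add_neg]
  rfl

lemma horizontalLift_eq_correctedLift (J : AlmostComplexStructure E M) (D : Connection E M) :
    horizontalLift J D = correctedLift J.toFun (bracketJ (symmetrized D) J) :=
  funext fun _ ↦ (ContinuousLinearMap.comp_add ..).symm

end

end AlmostComplex

end

theorem corollary2_general
    {E₁ : Type*} [NormedAddCommGroup E₁] [NormedSpace ℝ E₁] [FiniteDimensional ℝ E₁]
    {E₂ : Type*} [NormedAddCommGroup E₂] [NormedSpace ℝ E₂] [FiniteDimensional ℝ E₂]
    {M₁ : Type*} [TopologicalSpace M₁] [ChartedSpace E₁ M₁] [IsManifold 𝓘(ℝ, E₁) ∞ M₁]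
    {M₂ : Type*} [TopologicalSpace M₂] [ChartedSpace E₂ M₂] [IsManifold 𝓘(ℝ, E₂) ∞ M₂]
    (J₁ : AlmostComplexStructure E₁ M₁) (J₂ : AlmostComplexStructure E₂ M₂)
    (f : M₁ ≃ₘ^∞⟮𝓘(ℝ, E₁), 𝓘(ℝ, E₂)⟯ M₂) :
    (IsHolomorphic (cotangentModel E₁) (cotangentModel E₂)
        (completeLift J₁) (completeLift J₂) (cotangentLift f) ↔
      IsHolomorphic 𝓘(ℝ, E₁) 𝓘(ℝ, E₂) J₁.toFun J₂.toFun f) ∧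
    ∀ (D₁ : Connection E₁ M₁) (D₂ : Connection E₂ M₂),
      IsHolomorphic (cotangentModel E₁) (cotangentModel E₂)
          (horizontalLift J₁ D₁) (horizontalLift J₂ D₂) (cotangentLift f) ↔
        IsHolomorphic 𝓘(ℝ, E₁) 𝓘(ℝ, E₂) J₁.toFun J₂.toFun f ∧
          ∀ y : M₂, pushTensor f (bracketJ (symmetrized D₁) J₁) y =
            bracketJ (symmetrized D₂) J₂ y := by
  have hlift := isHolomorphic_cotangentLift_correctedLift_iff (f := f)
    J₁.mdiffEndoFieldAt J₂.mdiffEndoFieldAt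
  constructor
  · rw [completeLift_eq_correctedLift, completeLift_eq_correctedLift, hlift]
    refine and_iff_left_of_imp fun hf ↦ pushTensor_eq_of_mfderiv f fun x u v ↦ ?_
    exact (map_smul (mfderiv 𝓘(ℝ, E₁) 𝓘(ℝ, E₂) f x) _ _).trans
      congr((-(1 / 2) : ℝ) • $(hf.mfderiv_complexNijenhuis x u v))
  · intro D₁ D₂
    rw [horizontalLift_eq_correctedLift, horizontalLift_eq_correctedLift, hlift]

theorem corollary2
    {E₁ : Type*} [NormedAddCommGroup E₁] [NormedSpace ℝ E₁] [FiniteDimensional ℝ E₁]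
    {E₂ : Type*} [NormedAddCommGroup E₂] [NormedSpace ℝ E₂] [FiniteDimensional ℝ E₂]
    {M₁ : Type*} [TopologicalSpace M₁] [ChartedSpace E₁ M₁] [IsManifold 𝓘(ℝ, E₁) ∞ M₁]
    {M₂ : Type*} [TopologicalSpace M₂] [ChartedSpace E₂ M₂] [IsManifold 𝓘(ℝ, E₂) ∞ M₂]
    (J₁ : AlmostComplexStructure E₁ M₁) (J₂ : AlmostComplexStructure E₂ M₂)
    (f : M₁ ≃ₘ^∞⟮𝓘(ℝ, E₁), 𝓘(ℝ, E₂)⟯ M₂) :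
    (IsHolomorphic (cotangentModel E₁) (cotangentModel E₂)
        (completeLift J₁) (completeLift J₂) (cotangentLift f) ↔
      IsHolomorphic 𝓘(ℝ, E₁) 𝓘(ℝ, E₂) J₁.toFun J₂.toFun f) ∧
    ∀ (D₁ : Connection E₁ M₁) (D₂ : Connection E₂ M₂)
      [D₁.ContMDiffCovariantDerivative ∞] [D₂.ContMDiffCovariantDerivative ∞],
      IsHolomorphic (cotangentModel E₁) (cotangentModel E₂)
          (horizontalLift J₁ D₁) (horizontalLift J₂ D₂) (cotangentLift f) ↔
        IsHolomorphic 𝓘(ℝ, E₁) 𝓘(ℝ, E₂) J₁.toFun J₂.toFun f ∧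
          ∀ y : M₂, pushTensor f (bracketJ (symmetrized D₁) J₁) y =
            bracketJ (symmetrized D₂) J₂ y :=
  ⟨(corollary2_general J₁ J₂ f).1, fun D₁ D₂ _ _ ↦ (corollary2_general J₁ J₂ f).2 D₁ D₂⟩
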